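/- Let $n\ge 1$ and $\lambda>0$, and let $m(\xi,\eta)=(1-(|\xi|^2+|\eta|^2))_+^{\lambda}$ for $(\xi,\eta)\in\mathbb R^n\times\mathbb R^n$. Fix a smooth, nonnegative, nonincreasing function $\varphi$ on $\mathbb R$ with $\varphi(s)=1$ for $s\le 1/2$ and $\varphi(s)=0$ for $s\ge 1$. Put $\varphi_j(s)=\varphi(2^{j+1}(s+2^{-j}-1))$ for $j\ge1$, $\psi_0=\varphi_1$, $\psi_j=\varphi_{j+1}-\varphi_j$ for $j\ge 1$, and $m_j(\xi,\eta)=m(\xi,\eta)\,\psi_j(|(\xi,\eta)|)$ for $j\ge 0$. For a symbol $\sigma\in\{m,m_0,m_1,\dots\}$ let $K_\sigma(y,z)=\int\int\sigma(\xi,\eta)e^{2\pi i(y\cdot\xi+z\cdot\eta)}\,d\xi\,d\eta$ be its kernel. For $t>0$ and $x\in\mathbb R^n$ define $$A^\sigma_t(f,g)(x)=\int_{\mathbb R^{2n}}t^{-2n}K_\sigma\Big(\frac{x-y}t,\frac{x-z}t\Big)f(y)g(z)\,dy\,dz ,$$ and let $T_\sigma(f,g)(x)=\sup_{t>0}|A^\sigma_t(f,g)(x)|$.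 Write $T_*=T^\lambda_*=T_{m}$ (the bilinear maximal Bochner--Riesz operator) and $T_j=T_{m_j}$. Let $M$ denote the centered Hardy--Littlewood maximal function, and let $$\|T\|_{L^{p_1}\times L^{p_2}\to L^p}=\sup_{\|f\|_{L^{p_1}}\le1}\ \sup_{\|g\|_{L^{p_2}}\le 1}\|T(f,g)\|_{L^p}.$$ (i) Suppose $\lambda>n-1/2$. For Schwartz functions $f,g$ and all $t>0$, $x\in\mathbb R^n$, $$A^{m}_t(f,g)(x)=\int_{\mathbb R^n}\int_{\mathbb R^n}m(t\xi,t\eta)\widehat f(\xi)\widehat g(\eta)e^{2\pi i x\cdot(\xi+\eta)}\,d\xi\,d\eta .$$ There is a constant $C_0=C_0(n,\lambda)$ such that $T_*(f,g)(x)\le C_0\,M(f)(x)\,M(g)(x)$ for every $x\in\mathbb R^n$, whenever $f\in L^{p_1}(\mathbb R^n)$ and $g\in L^{p_2}(\mathbb R^n)$ with $1<p_1,p_2\le\infty$. Moreover, if $1<p_1,p_2\le\infty$ and $1/p=1/p_1+1/p_2$, then for all $f\in L^{p_1}$, $g\in L^{p_2}$ the integrals defining $A_t^{m}(f,g)(x)$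 converge absolutely for all $t>0$ and $x\in\mathbb R^n$, and there is a constant $C=C(n,\lambda,p_1,p_2)$ such that $\|T_*\|_{L^{p_1}\times L^{p_2}\to L^p}\le C$; that is, $T_*$ maps $L^{p_1}\times L^{p_2}$ to $L^p$ with $\|T_*(f,g)\|_{L^p}\le C\|f\|_{L^{p_1}}\|g\|_{L^{p_2}}$. (ii) Let $\lambda>0$ be arbitrary and $j\ge0$. For Schwartz functions $f,g$, $A^{m_j}_t(f,g)$ is likewise given by the Fourier integral of (i) with $m_j$ in place of $m$. If $1<p_1,p_2\le\infty$ and $1/p=1/p_1+1/p_2$, then for all $f\in L^{p_1}$, $g\in L^{p_2}$ the integrals defining $A_t^{m_j}(f,g)(x)$ converge absolutely for all $t>0$ and $x\in\mathbb R^n$, and there is a constant $C_j$, depending only on $j,n,\lambda,\varphi,p_1,p_2$, such that $\|T_j\|_{L^{p_1}\times L^{p_2}\to L^p}\le C_j$; that is, $T_j$ maps $L^{p_1}\times L^{p_2}$ to $L^p$ with $\|T_j(f,g)\|_{L^p}\le C_j\|f\|_{L^{p_1}}\|g\|_{L^{p_2}}$. -/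

import Mathlib

open MeasureTheory Filter
open scoped ENNReal NNReal ContDiff FourierTransform SchwartzMap

noncomputable section

namespace BilinearBochnerRiesz

/-- The space `ℝⁿ` with its Euclidean norm. -/
abbrev Rn (n : ℕ) : Type := EuclideanSpace ℝ (Fin n)

/-- The Euclidean length `|(ξ, η)|` of a point of `ℝⁿ × ℝⁿ = ℝ²ⁿ`. -/
def pairNorm {n : ℕ} (ξ η : Rn n) : ℝ := Real.sqrt (‖ξ‖ ^ 2 + ‖η‖ ^ 2)

/-- The Bochner-Riesz multiplier `m(ξ, η) = (1 - (|ξ|² + |η|²))₊ ^ lam`. -/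
def bochnerRiesz (n : ℕ) (lam : ℝ) (ξ η : Rn n) : ℝ :=
  (max 0 (1 - (‖ξ‖ ^ 2 + ‖η‖ ^ 2))) ^ lam

/-- The admissible cutoff functions from which the decomposition is built. -/
structure IsCutoff (φ : ℝ → ℝ) : Prop where
  smooth : ContDiff ℝ ∞ φ
  nonneg : ∀ s, 0 ≤ φ s
  antitone : Antitone φ
  eq_one : ∀ s, s ≤ 1 / 2 → φ s = 1
  eq_zero : ∀ s, 1 ≤ s → φ s = 0

/-- `φ_j(s) = φ(2^(j+1) (s + 2^(-j) - 1))`. -/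
def cutoffScale (φ : ℝ → ℝ) (j : ℕ) (s : ℝ) : ℝ :=
  φ ((2 : ℝ) ^ (j + 1) * (s + ((2 : ℝ) ^ j)⁻¹ - 1))

/-- `ψ_0 = φ_1`, and `ψ_j = φ_(j+1) - φ_j` for `j ≥ 1`. -/
def psi (φ : ℝ → ℝ) (j : ℕ) (s : ℝ) : ℝ :=
  if j = 0 then cutoffScale φ 1 s else cutoffScale φ (j + 1) s - cutoffScale φ j s

/-- The piece `m_j(ξ, η) = m(ξ, η) ψ_j(|(ξ, η)|)` of the Bochner-Riesz multiplier. -/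
def bochnerRieszPiece (n : ℕ) (lam : ℝ) (φ : ℝ → ℝ) (j : ℕ) (ξ η : Rn n) : ℝ :=
  bochnerRiesz n lam ξ η * psi φ j (pairNorm ξ η)

/-- The bilinear multiplier operator with symbol `σ(tξ, tη)`, on Schwartz functions:
`∫∫ σ(tξ, tη) f^(ξ) g^(η) e^(2πi x·(ξ+η)) dξ dη`. -/
def fourierMean {n : ℕ} (σ : Rn n → Rn n → ℝ) (t : ℝ) (f g : 𝓢(Rn n, ℂ)) (x : Rn n) : ℂ :=
  ∫ ξ : Rn n, ∫ η : Rn n, (σ (t • ξ) (t • η) : ℂ) * 𝓕 f ξ * 𝓕 g η *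
    Complex.exp (2 * Real.pi * Complex.I * (inner ℝ x (ξ + η) : ℝ))

/-- The kernel of the symbol `σ`: its inverse Fourier transform on `ℝ²ⁿ`. -/
def kernel {n : ℕ} (σ : Rn n → Rn n → ℝ) (y z : Rn n) : ℂ :=
  ∫ ξ : Rn n, ∫ η : Rn n, (σ ξ η : ℂ) *
    Complex.exp (2 * Real.pi * Complex.I * (inner ℝ y ξ + inner ℝ z η : ℝ))

/-- The integrand `(y, z) ↦ t^(-2n) K((x-y)/t, (x-z)/t) f(y) g(z)`. -/
def kernelIntegrand {n : ℕ} (σ : Rn n → Rn n → ℝ) (t : ℝ) (f g : Rn n → ℂ) (x : Rn n)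
    (w : Rn n × Rn n) : ℂ :=
  (((t ^ (2 * n))⁻¹ : ℝ) : ℂ) * kernel σ (t⁻¹ • (x - w.1)) (t⁻¹ • (x - w.2)) * f w.1 * g w.2

/-- The bilinear operator with symbol `σ(tξ, tη)` on general functions, written through its
kernel; it is the form of the operator that makes sense on `L^p₁ × L^p₂`. -/
def kernelMean {n : ℕ} (σ : Rn n → Rn n → ℝ) (t : ℝ) (f g : Rn n → ℂ) (x : Rn n) : ℂ :=
  ∫ w : Rn n × Rn n, kernelIntegrand σ t f g x w

/-- The bilinear maximal operator of the symbol `σ`, with values in `[0, ∞]`. -/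
def maximalOp {n : ℕ} (σ : Rn n → Rn n → ℝ) (f g : Rn n → ℂ) (x : Rn n) : ℝ≥0∞ :=
  ⨆ (t : ℝ) (_ : 0 < t), ‖kernelMean σ t f g x‖ₑ

/-- The bilinear maximal Bochner-Riesz operator `T_*`. -/
def Tstar (n : ℕ) (lam : ℝ) (f g : Rn n → ℂ) : Rn n → ℝ≥0∞ :=
  maximalOp (bochnerRiesz n lam) f g

/-- The maximal operator `T_j` of the piece `m_j`. -/
def Tpiece (n : ℕ) (lam : ℝ) (φ : ℝ → ℝ) (j : ℕ) (f g : Rn n → ℂ) : Rn n → ℝ≥0∞ :=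
  maximalOp (bochnerRieszPiece n lam φ j) f g

/-- The centered Hardy-Littlewood maximal function. -/
def hardyLittlewood {n : ℕ} (f : Rn n → ℂ) (x : Rn n) : ℝ≥0∞ :=
  ⨆ (r : ℝ) (_ : 0 < r), (volume (Metric.ball x r))⁻¹ * ∫⁻ y in Metric.ball x r, ‖f y‖ₑ

/-- `‖T‖_(L^p₁ × L^p₂ → L^p)`: the supremum of `‖T(f, g)‖_p` over `f`, `g` in the closed unit
balls of `L^p₁` and `L^p₂`. -/
def bilinearNorm {n : ℕ} (T : (Rn n → ℂ) → (Rn n → ℂ) → Rn n → ℝ≥0∞) (p₁ p₂ p : ℝ≥0∞) :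
    ℝ≥0∞ :=
  ⨆ (f : Rn n → ℂ) (_ : MemLp f p₁ volume ∧ eLpNorm f p₁ volume ≤ 1)
    (g : Rn n → ℂ) (_ : MemLp g p₂ volume ∧ eLpNorm g p₂ volume ≤ 1),
    eLpNorm (T f g) p volume

/-- The kernel form of the operators with symbol `σ(tξ, tη)`, `t > 0`, agrees on Schwartz
functions with the Fourier form. -/
def AgreesOnSchwartz {n : ℕ} (σ : Rn n → Rn n → ℝ) : Prop :=
  ∀ (f g : 𝓢(Rn n, ℂ)) (t : ℝ), 0 < t → ∀ x : Rn n,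
    kernelMean σ t f g x = fourierMean σ t f g x

/-- The kernel integrals with symbol `σ` converge absolutely, for every `t > 0` and at every
point, for all inputs from `L^p₁ × L^p₂`. -/
def ConvergesOn {n : ℕ} (σ : Rn n → Rn n → ℝ) (p₁ p₂ : ℝ≥0∞) : Prop :=
  ∀ f g : Rn n → ℂ, MemLp f p₁ volume → MemLp g p₂ volume → ∀ t : ℝ, 0 < t → ∀ x : Rn n,
    Integrable (kernelIntegrand σ t f g x) volume

/-- `T` maps `L^p₁ × L^p₂` to `L^p` with `‖T(f, g)‖_p ≤ C ‖f‖_p₁ ‖g‖_p₂`. -/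
def BoundedWith {n : ℕ} (T : (Rn n → ℂ) → (Rn n → ℂ) → Rn n → ℝ≥0∞) (p₁ p₂ p : ℝ≥0∞)
    (C : ℝ≥0) : Prop :=
  ∀ f g : Rn n → ℂ, MemLp f p₁ volume → MemLp g p₂ volume →
    MemLp (T f g) p volume ∧
    eLpNorm (T f g) p volume ≤ C * eLpNorm f p₁ volume * eLpNorm g p₂ volume

end BilinearBochnerRiesz

end

namespace BilinearBochnerRiesz

open Metric

/-! ### The centered maximal function: measurability, weak type (1, 1), truncation. -/

section HardyLittlewood

variable {n : ℕ}

/-! Everything reduces to a size estimate for the kernel. Suppose |K(y, z)| ≤ A (1 + |y|)^(-s) (1 +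
|z|)^(-s) with s > n (`KernelDecay`). The integrand of A_t(f, g)(x) is then dominated by a function
of y times a function of z, so the double integral splits. Each factor is an average of |f| or |g|
against t^(-n) (1 + |x - y|/t)^(-s), which dyadic shells bound by a multiple of the maximal function
at x, uniformly in t (`exists_lintegral_japanese_le_hardyLittlewood`). Hence the maximal operator is
at most C M(f) M(g) pointwise, and Hölder together with the L^p bounds for M gives the norm
estimate, including target exponents below 1 (`KernelDecay.exists_boundedWith`). The Fourier form on
Schwartz functions needs only an integrable symbol and Fubini.

For the full symbol m, put d = 2n - 1. Rotate the frequency w = (y, z) to a coordinate axis of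
ℝ^(2n) and integrate out the other d variables: the kernel becomes a constant times the
one-dimensional Fourier integral of (1 - s²)^ν on [-1, 1] at |w|, with ν = lam + d/2
(`kernel_bochnerRiesz_eq`). That integral is O(|w|^(-ν-1)). For -1 < ν ≤ 0 this follows by shifting
half a period, since the profile is monotone on each half of the interval; larger ν follow by
integration by parts, each step raising ν by one and gaining a factor 1/|w|
(`exists_norm_evenOsc_oddOsc_le`). No Bessel asymptotics enter. Since ν + 1 = lam + n + 1/2, half of
this decay can be given to each of y and z with an exponent above n exactly when lam > n - 1/2.

A piece m_j is cut off away from the unit sphere, the only place where m is not smooth. It is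
therefore a test function, and its kernel is Schwartz (`exists_kernelDecay_bochnerRieszPiece`). -/

theorem volume_ball_eq (x : Rn n) {r : ℝ} (hr : 0 < r) :
    volume (ball x r) = ENNReal.ofReal (r ^ n) * volume (ball (0 : Rn n) 1) := by
  rw [Measure.addHaar_ball_of_pos _ _ hr]
  simp

theorem hardyLittlewood_congr_ae {f g : Rn n → ℂ} (h : f =ᵐ[volume] g) :
    hardyLittlewood f = hardyLittlewood g := by
  funext x
  unfold hardyLittlewood
  refine iSup_congr fun r => iSup_congr fun _ => ?_
  congr 1
  refine lintegral_congr_ae (ae_restrict_of_ae ?_)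
  filter_upwards [h] with y hy
  rw [hy]

theorem setLIntegral_ball_le (f : Rn n → ℂ) (x : Rn n) {r : ℝ} (hr : 0 < r) :
    ∫⁻ y in ball x r, ‖f y‖ₑ ≤ volume (ball x r) * hardyLittlewood f x := by
  have h : (volume (ball x r))⁻¹ * ∫⁻ y in ball x r, ‖f y‖ₑ ≤ hardyLittlewood f x :=
    le_iSup₂ (f := fun (r : ℝ) (_ : 0 < r) =>
      (volume (ball x r))⁻¹ * ∫⁻ y in ball x r, ‖f y‖ₑ) r hr
  have h0 : volume (ball x r) ≠ 0 := (measure_ball_pos volume x hr).ne'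
  have h1 : volume (ball x r) ≠ ⊤ := measure_ball_lt_top.ne
  calc ∫⁻ y in ball x r, ‖f y‖ₑ
      = volume (ball x r) * ((volume (ball x r))⁻¹ * ∫⁻ y in ball x r, ‖f y‖ₑ) := by
        rw [← mul_assoc, ENNReal.mul_inv_cancel h0 h1, one_mul]
    _ ≤ _ := by gcongr

theorem exists_ball_of_lt_hardyLittlewood {f : Rn n → ℂ} {x : Rn n} {a : ℝ≥0∞}
    (h : a < hardyLittlewood f x) :
    ∃ r : ℝ, 0 < r ∧ a * volume (ball x r) < ∫⁻ y in ball x r, ‖f y‖ₑ := by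
  simp only [hardyLittlewood, lt_iSup_iff] at h
  obtain ⟨r, hr, h⟩ := h
  refine ⟨r, hr, ?_⟩
  rw [mul_comm, ← div_eq_mul_inv] at h
  exact ENNReal.mul_lt_of_lt_div h

/-- A slightly smaller concentric ball already carries more than c, and it stays inside the ball of
radius r about every nearby center. No measurability of F is needed. -/
theorem lowerSemicontinuous_setLIntegral_ball (F : Rn n → ℝ≥0∞) (r : ℝ) :
    LowerSemicontinuous fun x => ∫⁻ y in ball x r, F y := by
  intro x c hc
  have hmono : Monotone fun k : ℕ => ball x (r - 1 / ((k : ℝ) + 1)) := by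
    intro k l hkl
    exact ball_subset_ball (by gcongr)
  have hU : ⋃ k : ℕ, ball x (r - 1 / ((k : ℝ) + 1)) = ball x r := by
    ext y
    simp only [Set.mem_iUnion, mem_ball]
    constructor
    · rintro ⟨k, hk⟩
      have : (0 : ℝ) < 1 / ((k : ℝ) + 1) := by positivity
      linarith
    · intro hy
      obtain ⟨k, hk⟩ := exists_nat_one_div_lt (sub_pos.2 hy)
      exact ⟨k, by linarith⟩
  have ht : Tendsto (fun k : ℕ => ∫⁻ y in ball x (r - 1 / ((k : ℝ) + 1)), F y) atTop
      (nhds (∫⁻ y in ball x r, F y)) := by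
    -- Continuity from below of the measure with density F plays the role of monotone convergence.
    have := tendsto_measure_iUnion_atTop (μ := volume.withDensity F) hmono
    rw [hU] at this
    simpa [Function.comp_def, withDensity_apply _ measurableSet_ball] using this
  obtain ⟨k, hk⟩ := (ht.eventually (lt_mem_nhds hc)).exists
  have hpos : (0 : ℝ) < 1 / ((k : ℝ) + 1) := by positivity
  filter_upwards [ball_mem_nhds x hpos] with y hy
  refine hk.trans_le (lintegral_mono_set ?_)
  apply ball_subset_ball'
  rw [dist_comm]
  rw [mem_ball] at hy
  linarith

theorem lowerSemicontinuous_hardyLittlewood (f : Rn n → ℂ) :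
    LowerSemicontinuous (hardyLittlewood f) := by
  refine lowerSemicontinuous_iSup fun r => lowerSemicontinuous_iSup fun hr => ?_
  have h0 : volume (ball (0 : Rn n) r) ≠ 0 := (measure_ball_pos volume _ hr).ne'
  have h1 : volume (ball (0 : Rn n) r) ≠ ⊤ := measure_ball_lt_top.ne
  intro x c hc
  simp only [Measure.addHaar_ball_center] at hc ⊢
  have hc' : c * volume (ball (0 : Rn n) r) < ∫⁻ y in ball x r, ‖f y‖ₑ := by
    rw [mul_comm, ← div_eq_mul_inv] at hc
    exact ENNReal.mul_lt_of_lt_div hc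
  filter_upwards [lowerSemicontinuous_setLIntegral_ball (fun y => ‖f y‖ₑ) r x _ hc'] with y hy
  rw [mul_comm, ← div_eq_mul_inv]
  exact (ENNReal.lt_div_iff_mul_lt (.inl h0) (.inl h1)).2 hy

theorem measurable_hardyLittlewood (f : Rn n → ℂ) : Measurable (hardyLittlewood f) :=
  (lowerSemicontinuous_hardyLittlewood f).measurable

/-- The weak-type `(1, 1)` inequality for the centered Hardy-Littlewood maximal function. -/
theorem mul_volume_lt_hardyLittlewood_le (hn : 1 ≤ n) (f : Rn n → ℂ) (a : ℝ≥0∞) :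
    a * volume {x | a < hardyLittlewood f x} ≤ 4 ^ n * ∫⁻ y, ‖f y‖ₑ := by
  rcases eq_or_ne (∫⁻ y, ‖f y‖ₑ) ⊤ with hf | hf
  · rw [hf, ENNReal.mul_top (by simp)]
    exact le_top
  rcases eq_or_ne a 0 with rfl | ha
  · simp
  rcases eq_or_ne a ⊤ with rfl | ha'
  · simp
  set E := {x | a < hardyLittlewood f x} with hE
  have hex : ∀ x ∈ E, ∃ r : ℝ, 0 < r ∧ a * volume (ball x r) < ∫⁻ y in ball x r, ‖f y‖ₑ :=
    fun x hx => exists_ball_of_lt_hardyLittlewood hx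
  choose! r hr0 hr using hex
  set β := volume (ball (0 : Rn n) 1) with hβ
  have hβ0 : β ≠ 0 := (measure_ball_pos volume _ one_pos).ne'
  have hβ1 : β ≠ ⊤ := measure_ball_lt_top.ne
  set R : ℝ≥0∞ := (∫⁻ y, ‖f y‖ₑ) / (a * β) with hR
  have hRtop : R ≠ ⊤ := ENNReal.div_ne_top hf (mul_ne_zero ha hβ0)
  have hbound : ∀ x ∈ E, r x ≤ max 1 R.toReal := by
    intro x hx
    rcases le_total (r x) 1 with h1 | h1
    · exact le_max_of_le_left h1
    -- The selected averages bound r^n; since n ≥ 1, r ≤ r^n for r ≥ 1, which bounds the radii as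
    -- the covering lemma requires.
    refine le_max_of_le_right ((le_self_pow₀ h1 (n := n) (by lia)).trans ?_)
    rw [← ENNReal.ofReal_le_iff_le_toReal hRtop, hR,
      ENNReal.le_div_iff_mul_le (.inl (mul_ne_zero ha hβ0)) (.inl (ENNReal.mul_ne_top ha' hβ1))]
    calc ENNReal.ofReal (r x ^ n) * (a * β) = a * volume (ball x (r x)) := by
          rw [volume_ball_eq x (hr0 x hx)]; ring
      _ ≤ ∫⁻ y in ball x (r x), ‖f y‖ₑ := (hr x hx).le
      _ ≤ ∫⁻ y, ‖f y‖ₑ := setLIntegral_le_lintegral _ _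
  -- Any enlargement factor above 3 would do; the choice 4 produces the constant 4^n.
  obtain ⟨u, huE, hdisj, hcov⟩ := Vitali.exists_disjoint_subfamily_covering_enlargement_ball
    E id r _ hbound 4 (by norm_num)
  have hcount : u.Countable := hdisj.countable_of_isOpen (fun _ _ => isOpen_ball)
    fun x hx => nonempty_ball.2 (hr0 x (huE hx))
  have hsub : E ⊆ ⋃ b ∈ u, ball b (4 * r b) := by
    intro x hx
    obtain ⟨b, hb, hsub⟩ := hcov x hx
    exact Set.mem_biUnion hb (hsub (mem_ball_self (hr0 x hx)))
  have := hcount.to_subtype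
  calc a * volume E ≤ a * ∑' b : u, volume (ball (b : Rn n) (4 * r b)) := by
        gcongr
        exact (measure_mono hsub).trans (measure_biUnion_le _ hcount _)
    _ = ∑' b : u, 4 ^ n * (a * volume (ball (b : Rn n) (r b))) := by
        rw [← ENNReal.tsum_mul_left]
        congr 1 with b
        have hb := hr0 _ (huE b.2)
        rw [volume_ball_eq _ hb, volume_ball_eq _ (by positivity), mul_pow,
          ENNReal.ofReal_mul (by positivity)]
        rw [ENNReal.ofReal_pow (by norm_num)]
        norm_num
        ring
    _ ≤ ∑' b : u, 4 ^ n * ∫⁻ y in ball (b : Rn n) (r b), ‖f y‖ₑ := by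
        gcongr with b
        exact (hr _ (huE b.2)).le
    _ = 4 ^ n * ∫⁻ y in ⋃ b : u, ball (b : Rn n) (r b), ‖f y‖ₑ := by
        rw [ENNReal.tsum_mul_left, lintegral_iUnion (fun _ => measurableSet_ball)]
        exact hdisj.subtype _ _
    _ ≤ 4 ^ n * ∫⁻ y, ‖f y‖ₑ := by
        gcongr
        exact Measure.restrict_le_self

theorem hardyLittlewood_le_of_ae_le {f : Rn n → ℂ} {b : ℝ≥0∞} (h : ∀ᵐ y, ‖f y‖ₑ ≤ b)
    (x : Rn n) : hardyLittlewood f x ≤ b := by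
  refine iSup₂_le fun r hr => ?_
  have h0 : volume (ball x r) ≠ 0 := (measure_ball_pos volume x hr).ne'
  have h1 : volume (ball x r) ≠ ⊤ := measure_ball_lt_top.ne
  calc (volume (ball x r))⁻¹ * ∫⁻ y in ball x r, ‖f y‖ₑ
      ≤ (volume (ball x r))⁻¹ * ∫⁻ _ in ball x r, b := by
        gcongr 1
        exact lintegral_mono_ae (ae_restrict_of_ae h)
    _ = b := by
        rw [setLIntegral_const, mul_comm b, ← mul_assoc, ENNReal.inv_mul_cancel h0 h1, one_mul]

/-- The part of f of size at most b has averages at most b. This splitting lets the weak-type bound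
be applied to the large part alone. -/
theorem hardyLittlewood_le_add_of_truncation (f : Rn n → ℂ) (b : ℝ≥0∞) (x : Rn n) :
    hardyLittlewood f x ≤ b + hardyLittlewood ({y | b < ‖f y‖ₑ}.indicator f) x := by
  refine iSup₂_le fun r hr => ?_
  have h0 : volume (ball x r) ≠ 0 := (measure_ball_pos volume x hr).ne'
  have h1 : volume (ball x r) ≠ ⊤ := measure_ball_lt_top.ne
  have hle : ∀ y, ‖f y‖ₑ ≤ b + ‖({y | b < ‖f y‖ₑ}.indicator f) y‖ₑ := by
    intro y
    by_cases hy : b < ‖f y‖ₑ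
    · rw [Set.indicator_of_mem (by exact hy)]
      exact le_add_self
    · exact (not_lt.1 hy).trans le_self_add
  calc (volume (ball x r))⁻¹ * ∫⁻ y in ball x r, ‖f y‖ₑ
      ≤ (volume (ball x r))⁻¹ * ∫⁻ y in ball x r,
          (b + ‖({y | b < ‖f y‖ₑ}.indicator f) y‖ₑ) := by
        gcongr with y
        exact hle y
    _ = b + (volume (ball x r))⁻¹ * ∫⁻ y in ball x r, ‖({y | b < ‖f y‖ₑ}.indicator f) y‖ₑ := by
        rw [lintegral_add_left measurable_const, mul_add, setLIntegral_const, mul_comm b,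
          ← mul_assoc, ENNReal.inv_mul_cancel h0 h1, one_mul]
    _ ≤ _ := by
        gcongr
        exact le_iSup₂ (f := fun (r : ℝ) (_ : 0 < r) => (volume (ball x r))⁻¹ *
          ∫⁻ y in ball x r, ‖({y | b < ‖f y‖ₑ}.indicator f) y‖ₑ) r hr

/-- Layer cake formula for a single extended nonnegative number. -/
theorem lintegral_layer_rpow (y : ℝ≥0∞) {p : ℝ} (hp : 0 < p) :
    ∫⁻ a in Set.Ioi (0 : ℝ), {a : ℝ | ENNReal.ofReal a < y}.indicator
      (fun a => ENNReal.ofReal (p * a ^ (p - 1))) a = y ^ p := by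
  have hfin : ∀ b : ℝ, 0 ≤ b → ∫⁻ a in Set.Ioi (0 : ℝ),
      {a : ℝ | ENNReal.ofReal a < ENNReal.ofReal b}.indicator
      (fun a => ENNReal.ofReal (p * a ^ (p - 1))) a = ENNReal.ofReal b ^ p := by
    intro b hb
    have hset : ∀ a ∈ Set.Ioi (0 : ℝ), {a : ℝ | ENNReal.ofReal a < ENNReal.ofReal b}.indicator
        (fun a => ENNReal.ofReal (p * a ^ (p - 1))) a =
        (Set.Ioo 0 b).indicator (fun a => ENNReal.ofReal (p * a ^ (p - 1))) a := by
      intro a ha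
      have ha : 0 < a := ha
      have : (a ∈ {a : ℝ | ENNReal.ofReal a < ENNReal.ofReal b}) ↔ a ∈ Set.Ioo 0 b := by
        rw [Set.mem_ofPred_eq, ENNReal.ofReal_lt_ofReal_iff_of_nonneg ha.le]
        simp [ha]
      by_cases hab : a ∈ Set.Ioo 0 b
      · rw [Set.indicator_of_mem hab, Set.indicator_of_mem (this.2 hab)]
      · rw [Set.indicator_of_notMem hab, Set.indicator_of_notMem (fun h => hab (this.1 h))]
    rw [setLIntegral_congr_fun measurableSet_Ioi hset, lintegral_indicator measurableSet_Ioo,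
      Measure.restrict_restrict measurableSet_Ioo,
      Set.inter_eq_left.2 (fun a ha => ha.1), ← Measure.restrict_congr_set Ioo_ae_eq_Ioc.symm]
    have hint : IntervalIntegrable (fun a : ℝ => p * a ^ (p - 1)) volume 0 b :=
      (intervalIntegral.intervalIntegrable_rpow' (by linarith)).const_mul p
    rw [intervalIntegrable_iff_integrableOn_Ioc_of_le hb] at hint
    rw [← ofReal_integral_eq_lintegral_ofReal hint, ← intervalIntegral.integral_of_le hb,
      intervalIntegral.integral_const_mul, integral_rpow (.inl (by linarith)),
      ENNReal.ofReal_rpow_of_nonneg hb hp.le]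
    · congr 1
      rw [sub_add_cancel, Real.zero_rpow hp.ne', sub_zero, mul_div_cancel₀ _ hp.ne']
    · filter_upwards [ae_restrict_mem measurableSet_Ioc] with a ha
      have := ha.1
      simp only [Pi.zero_apply]
      positivity
  rcases eq_or_ne y ⊤ with rfl | hy
  -- For y = ∞ the integral dominates the finite case at every level k, whose values tend to ∞.
  · rw [ENNReal.top_rpow_of_pos hp, eq_top_iff]
    have ht : Tendsto (fun k : ℕ => ENNReal.ofReal (k : ℝ) ^ p) atTop (nhds ⊤) := by
      have := (ENNReal.continuous_rpow_const (y := p)).tendsto ⊤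
      rw [ENNReal.top_rpow_of_pos hp] at this
      refine this.comp ?_
      simpa using ENNReal.tendsto_nat_nhds_top
    refine le_of_tendsto' ht fun k => ?_
    rw [← hfin k (by positivity)]
    refine lintegral_mono fun a => ?_
    refine Set.indicator_le_indicator_of_subset ?_ (fun _ => zero_le) a
    intro a _
    exact ENNReal.ofReal_lt_top
  · rw [← ENNReal.ofReal_toReal hy]
    exact hfin _ ENNReal.toReal_nonneg

end HardyLittlewood

/-! ### Strong type bounds and domination of power-weight averages. -/

section HardyLittlewoodStrong

variable {n : ℕ}

/-- Marcinkiewicz interpolation by hand: at height a, apply weak type (1, 1) to f truncated at a/2,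
then integrate in a and exchange the integrals. The inner integral is the layer cake formula with
exponent p - 1 at 2|f(x)|. -/
theorem lintegral_hardyLittlewood_rpow_le (hn : 1 ≤ n) {p : ℝ} (hp : 1 < p) {f : Rn n → ℂ}
    (hf : Measurable f) :
    ∫⁻ x, hardyLittlewood f x ^ p ≤
      (4 ^ n * 2 * ENNReal.ofReal (p / (p - 1)) * 2 ^ (p - 1)) * ∫⁻ x, ‖f x‖ₑ ^ p := by
  have hp0 : 0 < p := by linarith
  have hp1 : 0 < p - 1 := by linarith
  have hweak : ∀ a : ℝ, 0 < a →
      ENNReal.ofReal (p * a ^ (p - 1)) * volume {x | ENNReal.ofReal a < hardyLittlewood f x} ≤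
      (4 ^ n * 2 * ENNReal.ofReal (p / (p - 1))) * (ENNReal.ofReal ((p - 1) * a ^ (p - 1 - 1)) *
        ∫⁻ x, {x | ENNReal.ofReal (a / 2) < ‖f x‖ₑ}.indicator (fun x => ‖f x‖ₑ) x) := by
    intro a ha
    set b := ENNReal.ofReal (a / 2) with hb
    have hbb : ENNReal.ofReal a = b + b := by
      rw [hb, ← ENNReal.ofReal_add (by positivity) (by positivity), add_halves]
    set f₁ := {x | b < ‖f x‖ₑ}.indicator f with hf₁
    have hsub : {x | ENNReal.ofReal a < hardyLittlewood f x} ⊆ {x | b < hardyLittlewood f₁ x} := by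
      intro x hx
      have h : b + b < b + hardyLittlewood f₁ x := by
        rw [← hbb]
        exact lt_of_lt_of_le hx (hardyLittlewood_le_add_of_truncation f b x)
      exact lt_of_add_lt_add_left h
    have hf₁e : ∀ x, ‖f₁ x‖ₑ = {x | b < ‖f x‖ₑ}.indicator (fun x => ‖f x‖ₑ) x := fun x => by
      rw [hf₁, enorm_indicator_eq_indicator_enorm]
    have hw := mul_volume_lt_hardyLittlewood_le hn f₁ b
    simp only [hf₁e] at hw
    -- The density is split so that a factor b = a/2 feeds the weak-type inequality and what remains
    -- contains the layer cake density of exponent p - 1.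
    have hcoef : ENNReal.ofReal (p * a ^ (p - 1)) =
        2 * ENNReal.ofReal (p / (p - 1)) * ENNReal.ofReal ((p - 1) * a ^ (p - 1 - 1)) * b := by
      rw [hb, show (2 : ℝ≥0∞) = ENNReal.ofReal 2 by simp, ← ENNReal.ofReal_mul (by positivity),
        ← ENNReal.ofReal_mul (by positivity), ← ENNReal.ofReal_mul (by positivity)]
      congr 1
      rw [Real.rpow_sub_one ha.ne' (p - 1)]
      field_simp
    calc ENNReal.ofReal (p * a ^ (p - 1)) * volume {x | ENNReal.ofReal a < hardyLittlewood f x}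
        ≤ ENNReal.ofReal (p * a ^ (p - 1)) * volume {x | b < hardyLittlewood f₁ x} := by
          gcongr
      _ = 2 * ENNReal.ofReal (p / (p - 1)) * ENNReal.ofReal ((p - 1) * a ^ (p - 1 - 1)) *
          (b * volume {x | b < hardyLittlewood f₁ x}) := by
          rw [hcoef]; ring
      _ ≤ 2 * ENNReal.ofReal (p / (p - 1)) * ENNReal.ofReal ((p - 1) * a ^ (p - 1 - 1)) *
          (4 ^ n * ∫⁻ x, {x | b < ‖f x‖ₑ}.indicator (fun x => ‖f x‖ₑ) x) := by
          gcongr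
      _ = _ := by ring
  have hM := measurable_hardyLittlewood f
  calc ∫⁻ x, hardyLittlewood f x ^ p
      = ∫⁻ x, ∫⁻ a in Set.Ioi (0 : ℝ), {a : ℝ | ENNReal.ofReal a < hardyLittlewood f x}.indicator
          (fun a => ENNReal.ofReal (p * a ^ (p - 1))) a := by
        simp_rw [lintegral_layer_rpow _ hp0]
    _ = ∫⁻ a in Set.Ioi (0 : ℝ), ∫⁻ x, {a : ℝ | ENNReal.ofReal a < hardyLittlewood f x}.indicator
          (fun a => ENNReal.ofReal (p * a ^ (p - 1))) a := by
        apply lintegral_lintegral_swap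
        apply Measurable.aemeasurable
        exact Measurable.indicator (f := fun q : Rn n × ℝ => ENNReal.ofReal (p * q.2 ^ (p - 1)))
          (s := {q : Rn n × ℝ | ENNReal.ofReal q.2 < hardyLittlewood f q.1}) (by fun_prop)
          (measurableSet_lt (by fun_prop) (by fun_prop))
    _ ≤ ∫⁻ a in Set.Ioi (0 : ℝ), (4 ^ n * 2 * ENNReal.ofReal (p / (p - 1))) *
          (ENNReal.ofReal ((p - 1) * a ^ (p - 1 - 1)) *
        ∫⁻ x, {x | ENNReal.ofReal (a / 2) < ‖f x‖ₑ}.indicator (fun x => ‖f x‖ₑ) x) := by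
        refine setLIntegral_mono' measurableSet_Ioi fun a ha => ?_
        refine le_trans (le_of_eq ?_) (hweak a ha)
        rw [← lintegral_indicator_const (measurableSet_lt measurable_const hM)]
        rfl
    _ = (4 ^ n * 2 * ENNReal.ofReal (p / (p - 1))) * ∫⁻ a in Set.Ioi (0 : ℝ), ∫⁻ x,
          {a : ℝ | ENNReal.ofReal a < 2 * ‖f x‖ₑ}.indicator
          (fun a => ENNReal.ofReal ((p - 1) * a ^ (p - 1 - 1))) a * ‖f x‖ₑ := by
        rw [lintegral_const_mul' _ _ (by finiteness)]
        congr 1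
        refine setLIntegral_congr_fun measurableSet_Ioi fun a ha => ?_
        rw [← lintegral_const_mul' _ _ ENNReal.ofReal_ne_top]
        congr 1 with x
        have : ENNReal.ofReal (a / 2) < ‖f x‖ₑ ↔ ENNReal.ofReal a < 2 * ‖f x‖ₑ := by
          rw [ENNReal.ofReal_div_of_pos two_pos, ENNReal.ofReal_ofNat, mul_comm]
          exact ENNReal.div_lt_iff (.inl two_ne_zero) (.inl (by simp))
        simp only [Set.indicator_apply, Set.mem_ofPred_eq, this]
        split_ifs <;> simp
    _ = (4 ^ n * 2 * ENNReal.ofReal (p / (p - 1))) * ∫⁻ x, ∫⁻ a in Set.Ioi (0 : ℝ),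
          {a : ℝ | ENNReal.ofReal a < 2 * ‖f x‖ₑ}.indicator
          (fun a => ENNReal.ofReal ((p - 1) * a ^ (p - 1 - 1))) a * ‖f x‖ₑ := by
        congr 1
        symm
        apply lintegral_lintegral_swap
        apply Measurable.aemeasurable
        refine Measurable.mul ?_ (by fun_prop)
        exact Measurable.indicator
          (f := fun q : Rn n × ℝ => ENNReal.ofReal ((p - 1) * q.2 ^ (p - 1 - 1)))
          (s := {q : Rn n × ℝ | ENNReal.ofReal q.2 < 2 * ‖f q.1‖ₑ}) (by fun_prop)
          (measurableSet_lt (by fun_prop) (by fun_prop))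
    _ = (4 ^ n * 2 * ENNReal.ofReal (p / (p - 1))) * ∫⁻ x, 2 ^ (p - 1) * ‖f x‖ₑ ^ p := by
        congr 2 with x
        rw [lintegral_mul_const' _ _ enorm_ne_top, lintegral_layer_rpow _ hp1,
          ENNReal.mul_rpow_of_nonneg _ _ hp1.le, mul_assoc]
        congr 1
        conv_rhs => rw [← sub_add_cancel p 1, ENNReal.rpow_add_of_nonneg _ _ hp1.le zero_le_one,
          ENNReal.rpow_one]
    _ = _ := by
        rw [lintegral_const_mul' _ _ (by finiteness)]
        ring

/-- The strong-type `(p, p)` inequality for the centered Hardy-Littlewood maximal function. -/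
theorem exists_eLpNorm_hardyLittlewood_le (hn : 1 ≤ n) {p : ℝ≥0∞} (hp : 1 < p) :
    ∃ C : ℝ≥0, ∀ f : Rn n → ℂ, AEStronglyMeasurable f volume →
      eLpNorm (hardyLittlewood f) p volume ≤ C * eLpNorm f p volume := by
  rcases eq_or_ne p ⊤ with rfl | hp'
  · refine ⟨1, fun f _ => ?_⟩
    rw [ENNReal.coe_one, one_mul, eLpNorm_exponent_top, eLpNorm_exponent_top]
    refine essSup_le_of_ae_le _ (Eventually.of_forall fun x => ?_)
    exact hardyLittlewood_le_of_ae_le (enorm_ae_le_eLpNormEssSup f volume) x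
  have hp0 : p ≠ 0 := (zero_lt_one.trans hp).ne'
  have hp1 : 1 < p.toReal := by
    rwa [← ENNReal.toReal_one, ENNReal.toReal_lt_toReal (by simp) hp']
  set A : ℝ≥0∞ := 4 ^ n * 2 * ENNReal.ofReal (p.toReal / (p.toReal - 1)) * 2 ^ (p.toReal - 1)
  have hA : A ≠ ⊤ := by
    have : (2 : ℝ≥0∞) ^ (p.toReal - 1) ≠ ⊤ :=
      ENNReal.rpow_ne_top_of_nonneg (by linarith) (by simp)
    finiteness
  have hA' : A ^ (1 / p.toReal) ≠ ⊤ := ENNReal.rpow_ne_top_of_nonneg (by positivity) hA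
  refine ⟨(A ^ (1 / p.toReal)).toNNReal, fun f hf => ?_⟩
  rw [ENNReal.coe_toNNReal hA', hardyLittlewood_congr_ae hf.ae_eq_mk,
    eLpNorm_congr_ae hf.ae_eq_mk, eLpNorm_eq_lintegral_rpow_enorm_toReal hp0 hp',
    eLpNorm_eq_lintegral_rpow_enorm_toReal hp0 hp', ← ENNReal.mul_rpow_of_nonneg _ _ (by positivity)]
  gcongr
  exact lintegral_hardyLittlewood_rpow_le hn hp1 hf.stronglyMeasurable_mk.measurable

/-- Averages against the kernel `t⁻ⁿ (1 + |x - y| / t) ^ (-s)` with `s > n` are dominated by the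
Hardy-Littlewood maximal function. -/
theorem exists_lintegral_japanese_le_hardyLittlewood {s : ℝ} (hs : (n : ℝ) < s) :
    ∃ C : ℝ≥0, ∀ (f : Rn n → ℂ), AEStronglyMeasurable f volume → ∀ (x : Rn n) (t : ℝ), 0 < t →
      ∫⁻ y, ENNReal.ofReal ((t ^ n)⁻¹ * (1 + ‖t⁻¹ • (x - y)‖) ^ (-s)) * ‖f y‖ₑ ≤
        C * hardyLittlewood f x := by
  set β := volume (ball (0 : Rn n) 1) with hβ
  have hβ1 : β ≠ ⊤ := measure_ball_lt_top.ne
  have hq : Summable fun k : ℕ => ((2 : ℝ) ^ ((n : ℝ) - s)) ^ k :=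
    summable_geometric_of_lt_one (by positivity)
      (Real.rpow_lt_one_of_one_lt_of_neg one_lt_two (by linarith))
  set S : ℝ≥0∞ := ∑' k : ℕ, ENNReal.ofReal (((2 : ℝ) ^ ((n : ℝ) - s)) ^ k) with hS
  have hS1 : S ≠ ⊤ := by
    rw [hS, ← ENNReal.ofReal_tsum_of_nonneg (fun k => by positivity) hq]
    exact ENNReal.ofReal_ne_top
  have hC : 2 ^ n * β * S ≠ ⊤ := by finiteness
  refine ⟨(2 ^ n * β * S).toNNReal, fun f hf x t ht => ?_⟩
  rw [ENNReal.coe_toNNReal hC]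
  have hpt : ∀ y, ENNReal.ofReal ((t ^ n)⁻¹ * (1 + ‖t⁻¹ • (x - y)‖) ^ (-s)) * ‖f y‖ₑ ≤
      ∑' k : ℕ, ENNReal.ofReal ((t ^ n)⁻¹ * ((2 : ℝ) ^ k) ^ (-s)) *
        (ball x (2 ^ (k + 1) * t)).indicator (fun y => ‖f y‖ₑ) y := by
    intro y
    -- With 2^k ≤ 1 + |x - y|/t < 2^(k+1), the weight is at most 2^(-ks) t^(-n) and y lies in the
    -- ball of radius 2^(k+1) t. The k-th term is then of order 2^(k(n-s)), and s > n makes the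
    -- series converge.
    obtain ⟨k, hk1, hk2⟩ := exists_nat_pow_near (x := 1 + ‖t⁻¹ • (x - y)‖) (y := 2)
      (by linarith [norm_nonneg (t⁻¹ • (x - y))]) one_lt_two
    have hy : y ∈ ball x (2 ^ (k + 1) * t) := by
      rw [norm_smul, norm_inv, Real.norm_of_nonneg ht.le] at hk2
      rw [mem_ball', dist_eq_norm, ← div_lt_iff₀ ht, div_eq_inv_mul]
      linarith
    refine le_trans ?_ (ENNReal.le_tsum k)
    rw [Set.indicator_of_mem hy]
    gcongr ENNReal.ofReal (_ * ?_) * _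
    exact Real.rpow_le_rpow_of_nonpos (by positivity) hk1
      (by linarith [Nat.cast_nonneg (α := ℝ) n])
  calc ∫⁻ y, ENNReal.ofReal ((t ^ n)⁻¹ * (1 + ‖t⁻¹ • (x - y)‖) ^ (-s)) * ‖f y‖ₑ
      ≤ ∫⁻ y, ∑' k : ℕ, ENNReal.ofReal ((t ^ n)⁻¹ * ((2 : ℝ) ^ k) ^ (-s)) *
        (ball x (2 ^ (k + 1) * t)).indicator (fun y => ‖f y‖ₑ) y := lintegral_mono hpt
    _ = ∑' k : ℕ, ENNReal.ofReal ((t ^ n)⁻¹ * ((2 : ℝ) ^ k) ^ (-s)) *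
        ∫⁻ y in ball x (2 ^ (k + 1) * t), ‖f y‖ₑ := by
        rw [lintegral_tsum fun k => (hf.enorm.indicator measurableSet_ball).const_mul _]
        congr 1 with k
        rw [lintegral_const_mul' _ _ ENNReal.ofReal_ne_top,
          lintegral_indicator measurableSet_ball]
    _ ≤ ∑' k : ℕ, ENNReal.ofReal ((t ^ n)⁻¹ * ((2 : ℝ) ^ k) ^ (-s)) *
        (volume (ball x (2 ^ (k + 1) * t)) * hardyLittlewood f x) := by
        gcongr with k
        exact setLIntegral_ball_le f x (by positivity)
    _ = ∑' k : ℕ, 2 ^ n * β * hardyLittlewood f x *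
          ENNReal.ofReal (((2 : ℝ) ^ ((n : ℝ) - s)) ^ k) := by
        congr 1 with k
        rw [volume_ball_eq x (by positivity), ← hβ, ← mul_assoc, ← mul_assoc,
          ← ENNReal.ofReal_mul (by positivity), show (2 : ℝ≥0∞) ^ n = ENNReal.ofReal (2 ^ n) by
            rw [ENNReal.ofReal_pow (by norm_num)]; simp]
        have : (t ^ n)⁻¹ * ((2 : ℝ) ^ k) ^ (-s) * (2 ^ (k + 1) * t) ^ n =
            2 ^ n * ((2 : ℝ) ^ ((n : ℝ) - s)) ^ k := by
          have e1 : ((2 : ℝ) ^ ((n : ℝ) - s)) ^ k = (2 ^ k) ^ n * ((2 : ℝ) ^ k) ^ (-s) := by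
            rw [← Real.rpow_natCast ((2 : ℝ) ^ ((n : ℝ) - s)) k, ← Real.rpow_mul (by norm_num),
              mul_comm _ (k : ℝ), Real.rpow_mul (by norm_num), Real.rpow_natCast, sub_eq_add_neg,
              Real.rpow_add (by positivity), Real.rpow_natCast]
          rw [e1, mul_pow, pow_succ, mul_pow]
          field_simp
        rw [this, ENNReal.ofReal_mul (by positivity)]
        ring
    _ = _ := by
        rw [ENNReal.tsum_mul_left, ← hS]
        ring

end HardyLittlewoodStrong

/-! ### Hölder's inequality and the integrable power weights. -/

section Multiplier

variable {n : ℕ}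

theorem eLpNorm_ennreal_const_mul {α : Type*} [MeasurableSpace α] {μ : Measure α} (c : ℝ≥0∞)
    {F : α → ℝ≥0∞} (hF : AEMeasurable F μ) {p : ℝ≥0∞} (hp : p ≠ 0) :
    eLpNorm (fun x => c * F x) p μ = c * eLpNorm F p μ := by
  rcases eq_or_ne p ⊤ with rfl | hp'
  · simp only [eLpNorm_exponent_top, eLpNormEssSup, enorm_eq_self]
    exact ENNReal.essSup_const_mul
  · have hp0 : 0 < p.toReal := ENNReal.toReal_pos hp hp'
    simp only [eLpNorm_eq_lintegral_rpow_enorm_toReal hp hp', enorm_eq_self,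
      ENNReal.mul_rpow_of_nonneg _ _ hp0.le]
    rw [lintegral_const_mul'' _ (hF.pow_const _), ENNReal.mul_rpow_of_nonneg _ _ (by positivity),
      ← ENNReal.rpow_mul, mul_one_div_cancel hp0.ne', ENNReal.rpow_one]

/-- Hölder's inequality for products of extended nonnegative functions. -/
theorem eLpNorm_ennreal_mul_le {α : Type*} [MeasurableSpace α] {μ : Measure α}
    {F G : α → ℝ≥0∞} (hF : AEMeasurable F μ) (hG : AEMeasurable G μ) {p₁ p₂ p : ℝ≥0∞}
    (hp₁ : p₁ ≠ 0) (hp₂ : p₂ ≠ 0) (hp : p⁻¹ = p₁⁻¹ + p₂⁻¹) :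
    eLpNorm (fun x => F x * G x) p μ ≤ eLpNorm F p₁ μ * eLpNorm G p₂ μ := by
  rcases eq_or_ne p₁ ⊤ with rfl | hp₁'
  · have : p = p₂ := by simpa using hp
    subst this
    rw [← eLpNorm_ennreal_const_mul _ hG hp₂]
    refine eLpNorm_mono_enorm_ae ?_
    filter_upwards [enorm_ae_le_eLpNormEssSup F μ] with x hx
    simp only [enorm_eq_self, eLpNorm_exponent_top] at hx ⊢
    gcongr
  rcases eq_or_ne p₂ ⊤ with rfl | hp₂'
  · have : p = p₁ := by simpa using hp
    subst this
    rw [mul_comm, ← eLpNorm_ennreal_const_mul _ hF hp₁]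
    refine eLpNorm_mono_enorm_ae ?_
    filter_upwards [enorm_ae_le_eLpNormEssSup G μ] with x hx
    simp only [enorm_eq_self, eLpNorm_exponent_top] at hx ⊢
    rw [mul_comm]
    gcongr
  have h1 : 0 < p₁.toReal := ENNReal.toReal_pos hp₁ hp₁'
  have h2 : 0 < p₂.toReal := ENNReal.toReal_pos hp₂ hp₂'
  have hp0 : p ≠ 0 := by
    rintro rfl
    rw [ENNReal.inv_zero] at hp
    exact ENNReal.add_ne_top.2 ⟨ENNReal.inv_ne_top.2 hp₁, ENNReal.inv_ne_top.2 hp₂⟩ hp.symm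
  have hp' : p ≠ ⊤ := by
    rintro rfl
    rw [ENNReal.inv_top] at hp
    exact hp₁' (ENNReal.inv_eq_zero.1 (add_eq_zero.1 hp.symm).1)
  have h0 : 0 < p.toReal := ENNReal.toReal_pos hp0 hp'
  have hpr : 1 / p.toReal = 1 / p₁.toReal + 1 / p₂.toReal := by
    have := congrArg ENNReal.toReal hp
    rw [ENNReal.toReal_add (ENNReal.inv_ne_top.2 hp₁) (ENNReal.inv_ne_top.2 hp₂)] at this
    simpa [ENNReal.toReal_inv] using this
  have hlt : p.toReal < p₁.toReal := by
    rw [← one_div_lt_one_div h1 h0, hpr]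
    have : 0 < 1 / p₂.toReal := by positivity
    linarith
  rw [eLpNorm_eq_lintegral_rpow_enorm_toReal hp0 hp', eLpNorm_eq_lintegral_rpow_enorm_toReal hp₁ hp₁',
    eLpNorm_eq_lintegral_rpow_enorm_toReal hp₂ hp₂']
  simpa using ENNReal.lintegral_Lp_mul_le_Lq_mul_Lr h0 hlt hpr μ hF hG

/-- The weight `t⁻ⁿ (1 + |x - y| / t) ^ (-s)`. -/
noncomputable def decayWeight (s t : ℝ) (x y : Rn n) : ℝ :=
  (t ^ n)⁻¹ * (1 + ‖t⁻¹ • (x - y)‖) ^ (-s)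

theorem decayWeight_nonneg (s : ℝ) {t : ℝ} (ht : 0 < t) (x y : Rn n) : 0 ≤ decayWeight s t x y := by
  unfold decayWeight
  positivity

theorem continuous_decayWeight (s t : ℝ) (x : Rn n) : Continuous (decayWeight s t x) := by
  unfold decayWeight
  refine continuous_const.mul (Continuous.rpow_const (by fun_prop) fun y => .inl ?_)
  positivity

theorem decayWeight_le {s : ℝ} (hs : 0 ≤ s) {t : ℝ} (ht : 0 < t) (x y : Rn n) :
    decayWeight s t x y ≤ (t ^ n)⁻¹ := by
  unfold decayWeight
  refine mul_le_of_le_one_right (by positivity) ?_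
  exact Real.rpow_le_one_of_one_le_of_nonpos (by linarith [norm_nonneg (t⁻¹ • (x - y))])
    (by linarith)

theorem integrable_decayWeight {s : ℝ} (hs : (n : ℝ) < s) {t : ℝ} (ht : 0 < t) (x : Rn n) :
    Integrable (decayWeight s t x) volume := by
  have h1 : Integrable (fun u : Rn n => (1 + ‖u‖) ^ (-s)) volume :=
    integrable_one_add_norm (by simpa using hs)
  have h2 := (integrable_comp_smul_iff volume _ (inv_ne_zero ht.ne')).2 h1
  exact (h2.comp_sub_left x).const_mul _

/-- Moving x by at most t changes 1 + |x - y|/t by at most a factor 2. This supplies a dominating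
function that is locally uniform in x. -/
theorem decayWeight_le_of_dist_le {s : ℝ} (hs : 0 ≤ s) {t : ℝ} (ht : 0 < t) {x x₀ : Rn n}
    (hx : dist x x₀ ≤ t) (y : Rn n) :
    decayWeight s t x y ≤ 2 ^ s * decayWeight s t x₀ y := by
  unfold decayWeight
  have h1 : ‖t⁻¹ • (x₀ - y)‖ ≤ ‖t⁻¹ • (x - y)‖ + 1 := by
    simp only [norm_smul, norm_inv, Real.norm_of_nonneg ht.le]
    rw [dist_comm, dist_eq_norm] at hx
    have h2 : ‖x₀ - y‖ ≤ ‖x - y‖ + t := by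
      calc ‖x₀ - y‖ = ‖(x₀ - x) + (x - y)‖ := by congr 1; abel
        _ ≤ ‖x₀ - x‖ + ‖x - y‖ := norm_add_le _ _
        _ ≤ _ := by linarith
    calc t⁻¹ * ‖x₀ - y‖ ≤ t⁻¹ * (‖x - y‖ + t) := by gcongr
      _ = _ := by field_simp
  have h3 : (2 * (1 + ‖t⁻¹ • (x - y)‖)) ^ (-s) ≤ (1 + ‖t⁻¹ • (x₀ - y)‖) ^ (-s) :=
    Real.rpow_le_rpow_of_nonpos (by positivity)
      (by linarith [norm_nonneg (t⁻¹ • (x - y))]) (by linarith)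
  rw [Real.mul_rpow (by norm_num) (by positivity), Real.rpow_neg (by norm_num)] at h3
  have h4 : (1 + ‖t⁻¹ • (x - y)‖) ^ (-s) ≤ 2 ^ s * (1 + ‖t⁻¹ • (x₀ - y)‖) ^ (-s) := by
    rwa [inv_mul_le_iff₀ (by positivity)] at h3
  calc (t ^ n)⁻¹ * (1 + ‖t⁻¹ • (x - y)‖) ^ (-s)
      ≤ (t ^ n)⁻¹ * (2 ^ s * (1 + ‖t⁻¹ • (x₀ - y)‖) ^ (-s)) := by gcongr
    _ = _ := by ring

theorem integrable_decayWeight_mul {s : ℝ} (hs : (n : ℝ) < s) {t : ℝ} (ht : 0 < t) (x : Rn n)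
    {p : ℝ≥0∞} (hp : 1 ≤ p) {f : Rn n → ℂ} (hf : MemLp f p volume) :
    Integrable (fun y => decayWeight s t x y * ‖f y‖) volume := by
  have hs0 : 0 ≤ s := (Nat.cast_nonneg n).trans hs.le
  have hw := integrable_decayWeight hs ht x
  have hwm : AEStronglyMeasurable (fun y => decayWeight s t x y * ‖f y‖) volume :=
    (continuous_decayWeight s t x).aestronglyMeasurable.mul hf.1.norm
  rcases eq_or_ne p ⊤ with rfl | hp'
  · have hfin := hf.2
    rw [eLpNorm_exponent_top] at hfin
    refine (hw.mul_const (eLpNormEssSup f volume).toReal).mono' hwm ?_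
    filter_upwards [enorm_ae_le_eLpNormEssSup f volume] with y hy
    rw [norm_mul, norm_norm, Real.norm_of_nonneg (decayWeight_nonneg s ht x y)]
    gcongr
    · exact decayWeight_nonneg s ht x y
    · rw [← toReal_enorm]
      exact ENNReal.toReal_mono hfin.ne hy
  · have hp0 : p ≠ 0 := (zero_lt_one.trans_le hp).ne'
    have hp1 : 1 ≤ p.toReal := by
      rwa [← ENNReal.toReal_one, ENNReal.toReal_le_toReal (by simp) hp']
    have hfp := hf.integrable_norm_rpow hp0 hp'
    -- In place of Hölder: where |f| ≤ 1 the weight itself dominates; elsewhere |f| ≤ |f|^p and the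
    -- weight is at most t^(-n).
    refine (hw.add (hfp.const_mul (t ^ n)⁻¹)).mono' hwm (Eventually.of_forall fun y => ?_)
    have hwn := decayWeight_nonneg s ht x y
    rw [norm_mul, norm_norm, Real.norm_of_nonneg hwn]
    simp only [Pi.add_apply]
    rcases le_total ‖f y‖ 1 with h | h
    · have : 0 ≤ (t ^ n)⁻¹ * ‖f y‖ ^ p.toReal := by positivity
      nlinarith [mul_le_of_le_one_right hwn h]
    · have h1 : ‖f y‖ ≤ ‖f y‖ ^ p.toReal := Real.self_le_rpow_of_one_le h hp1
      calc decayWeight s t x y * ‖f y‖ ≤ (t ^ n)⁻¹ * ‖f y‖ ^ p.toReal := by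
            gcongr
            exact decayWeight_le hs0 ht x y
        _ ≤ _ := by linarith

/-! ### From kernel decay to convergence, pointwise domination and boundedness. -/

variable {σ : Rn n → Rn n → ℝ}

theorem continuous_phase :
    Continuous fun q : (Rn n × Rn n) × (Rn n × Rn n) =>
      Complex.exp (2 * Real.pi * Complex.I * (inner ℝ q.1.1 q.2.1 + inner ℝ q.1.2 q.2.2 : ℝ)) := by
  fun_prop

theorem norm_exp_two_pi_mul_I (r : ℝ) : ‖Complex.exp (2 * Real.pi * Complex.I * (r : ℂ))‖ = 1 := by
  rw [show 2 * (Real.pi : ℂ) * Complex.I * (r : ℂ) = ((2 * Real.pi * r : ℝ) : ℂ) * Complex.I by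
    push_cast; ring]
  exact Complex.norm_exp_ofReal_mul_I _

theorem integrable_symbol_mul_phase (hσ : Integrable (fun v : Rn n × Rn n => σ v.1 v.2) volume)
    (y z : Rn n) :
    Integrable (fun v : Rn n × Rn n => (σ v.1 v.2 : ℂ) *
      Complex.exp (2 * Real.pi * Complex.I * (inner ℝ y v.1 + inner ℝ z v.2 : ℝ))) volume := by
  refine hσ.ofReal.mul_bdd (c := 1) ?_ (Eventually.of_forall fun v =>
    (norm_exp_two_pi_mul_I _).le)
  exact (continuous_phase.comp (by fun_prop :
    Continuous fun v : Rn n × Rn n => ((y, z), v))).aestronglyMeasurable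

theorem kernel_eq_integral_prod (hσ : Integrable (fun v : Rn n × Rn n => σ v.1 v.2) volume)
    (y z : Rn n) :
    kernel σ y z = ∫ v : Rn n × Rn n, (σ v.1 v.2 : ℂ) *
      Complex.exp (2 * Real.pi * Complex.I * (inner ℝ y v.1 + inner ℝ z v.2 : ℝ)) :=
  (integral_prod _ (integrable_symbol_mul_phase hσ y z)).symm

theorem continuous_kernel (hσ : Integrable (fun v : Rn n × Rn n => σ v.1 v.2) volume) :
    Continuous fun w : Rn n × Rn n => kernel σ w.1 w.2 := by
  simp_rw [kernel_eq_integral_prod hσ]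
  refine continuous_of_dominated (bound := fun v => ‖σ v.1 v.2‖)
    (fun w => (integrable_symbol_mul_phase hσ w.1 w.2).1)
    (fun w => Eventually.of_forall fun v => ?_) hσ.norm (Eventually.of_forall fun v => ?_)
  · rw [norm_mul, norm_exp_two_pi_mul_I, mul_one, Complex.norm_real]
  · exact continuous_const.mul (continuous_phase.comp (by fun_prop :
      Continuous fun w : Rn n × Rn n => (w, v)))

/-- The kernel of `σ` is bounded by a product of integrable power weights of order `s`. -/
def KernelDecay (σ : Rn n → Rn n → ℝ) (s A : ℝ) : Prop :=
  ∀ y z : Rn n, ‖kernel σ y z‖ ≤ A * ((1 + ‖y‖) ^ (-s) * (1 + ‖z‖) ^ (-s))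

theorem KernelDecay.norm_kernelIntegrand_le {s A : ℝ} (hK : KernelDecay σ s A) {t : ℝ}
    (ht : 0 < t) (f g : Rn n → ℂ) (x : Rn n) (w : Rn n × Rn n) :
    ‖kernelIntegrand σ t f g x w‖ ≤
      A * ((decayWeight s t x w.1 * ‖f w.1‖) * (decayWeight s t x w.2 * ‖g w.2‖)) := by
  unfold kernelIntegrand decayWeight
  rw [norm_mul, norm_mul, norm_mul, Complex.norm_real, Real.norm_of_nonneg (by positivity)]
  calc (t ^ (2 * n))⁻¹ * ‖kernel σ (t⁻¹ • (x - w.1)) (t⁻¹ • (x - w.2))‖ * ‖f w.1‖ * ‖g w.2‖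
      ≤ (t ^ (2 * n))⁻¹ * (A * ((1 + ‖t⁻¹ • (x - w.1)‖) ^ (-s) *
          (1 + ‖t⁻¹ • (x - w.2)‖) ^ (-s))) * ‖f w.1‖ * ‖g w.2‖ := by
        gcongr
        exact hK _ _
    _ = _ := by
        rw [two_mul, pow_add, mul_inv]
        ring

theorem aestronglyMeasurable_kernelIntegrand
    (hσ : Integrable (fun v : Rn n × Rn n => σ v.1 v.2) volume) (t : ℝ) {f g : Rn n → ℂ}
    (hf : AEStronglyMeasurable f volume) (hg : AEStronglyMeasurable g volume) (x : Rn n) :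
    AEStronglyMeasurable (kernelIntegrand σ t f g x) volume := by
  unfold kernelIntegrand
  refine (AEStronglyMeasurable.mul ?_ hf.comp_fst).mul hg.comp_snd
  refine (continuous_const.mul ((continuous_kernel hσ).comp (?_ :
    Continuous fun w : Rn n × Rn n => (t⁻¹ • (x - w.1), t⁻¹ • (x - w.2))))).aestronglyMeasurable
  fun_prop

theorem KernelDecay.convergesOn {s A : ℝ} (hK : KernelDecay σ s A) (hs : (n : ℝ) < s)
    (hσ : Integrable (fun v : Rn n × Rn n => σ v.1 v.2) volume) {p₁ p₂ : ℝ≥0∞}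
    (hp₁ : 1 ≤ p₁) (hp₂ : 1 ≤ p₂) : ConvergesOn σ p₁ p₂ := by
  intro f g hf hg t ht x
  refine Integrable.mono' (((integrable_decayWeight_mul hs ht x hp₁ hf).mul_prod
    (integrable_decayWeight_mul hs ht x hp₂ hg)).const_mul A)
    (aestronglyMeasurable_kernelIntegrand hσ t hf.1 hg.1 x)
    (Eventually.of_forall fun w => hK.norm_kernelIntegrand_le ht f g x w)

/-- The product form of the decay separates the variables by Tonelli, and each factor is controlled
independently of t. Only measurability of the inputs enters, so the constant is independent of the
exponents. -/
theorem KernelDecay.exists_maximalOp_le {s A : ℝ} (hK : KernelDecay σ s A) (hs : (n : ℝ) < s) :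
    ∃ C : ℝ≥0, ∀ f g : Rn n → ℂ, AEStronglyMeasurable f volume → AEStronglyMeasurable g volume →
      ∀ x, maximalOp σ f g x ≤ C * hardyLittlewood f x * hardyLittlewood g x := by
  obtain ⟨C, hC⟩ := exists_lintegral_japanese_le_hardyLittlewood hs
  refine ⟨A.toNNReal * (C * C), fun f g hf hg x => iSup₂_le fun t ht => ?_⟩
  have hmeas : ∀ h : Rn n → ℂ, AEStronglyMeasurable h volume →
      AEMeasurable (fun y => ENNReal.ofReal (decayWeight s t x y) * ‖h y‖ₑ) volume := fun h hh =>
    (continuous_decayWeight s t x).measurable.ennreal_ofReal.aemeasurable.mul hh.enorm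
  calc ‖kernelMean σ t f g x‖ₑ ≤ ∫⁻ w, ‖kernelIntegrand σ t f g x w‖ₑ :=
        enorm_integral_le_lintegral_enorm _
    _ ≤ ∫⁻ w : Rn n × Rn n, ENNReal.ofReal A *
          ((ENNReal.ofReal (decayWeight s t x w.1) * ‖f w.1‖ₑ) *
          (ENNReal.ofReal (decayWeight s t x w.2) * ‖g w.2‖ₑ)) := by
        refine lintegral_mono fun w => ?_
        rw [← ofReal_norm, ← ofReal_norm, ← ofReal_norm,
          ← ENNReal.ofReal_mul (decayWeight_nonneg s ht x _),
          ← ENNReal.ofReal_mul (decayWeight_nonneg s ht x _),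
          ← ENNReal.ofReal_mul (mul_nonneg (decayWeight_nonneg s ht x _) (norm_nonneg _)),
          ← ENNReal.ofReal_mul' (mul_nonneg
            (mul_nonneg (decayWeight_nonneg s ht x _) (norm_nonneg _))
            (mul_nonneg (decayWeight_nonneg s ht x _) (norm_nonneg _)))]
        exact ENNReal.ofReal_le_ofReal (hK.norm_kernelIntegrand_le ht f g x w)
    _ = ENNReal.ofReal A * ((∫⁻ y, ENNReal.ofReal (decayWeight s t x y) * ‖f y‖ₑ) *
          ∫⁻ z, ENNReal.ofReal (decayWeight s t x z) * ‖g z‖ₑ) := by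
        rw [lintegral_const_mul' _ _ ENNReal.ofReal_ne_top, Measure.volume_eq_prod,
          lintegral_prod_mul (hmeas f hf) (hmeas g hg)]
    _ ≤ ENNReal.ofReal A * ((C * hardyLittlewood f x) * (C * hardyLittlewood g x)) := by
        gcongr
        · exact hC f hf x t ht
        · exact hC g hg x t ht
    _ = _ := by
        rw [ENNReal.ofReal]
        push_cast
        ring

/-- Continuity in x for each fixed t makes the supremum over the uncountable family t > 0 lower
semicontinuous, hence measurable. -/
theorem KernelDecay.continuous_kernelMean {s A : ℝ} (hK : KernelDecay σ s A) (hs : (n : ℝ) < s)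
    (hσ : Integrable (fun v : Rn n × Rn n => σ v.1 v.2) volume) {p₁ p₂ : ℝ≥0∞}
    (hp₁ : 1 ≤ p₁) (hp₂ : 1 ≤ p₂) {f g : Rn n → ℂ} (hf : MemLp f p₁ volume)
    (hg : MemLp g p₂ volume) {t : ℝ} (ht : 0 < t) : Continuous (kernelMean σ t f g) := by
  have hs0 : 0 ≤ s := (Nat.cast_nonneg n).trans hs.le
  -- At the origin both weights equal 1, so the decay bound itself forces A ≥ 0.
  have hA : 0 ≤ A := by
    have := (norm_nonneg _).trans (hK 0 0)
    simpa using this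
  refine continuous_iff_continuousAt.2 fun x₀ => ?_
  refine continuousAt_of_dominated (bound := fun w => A * (2 ^ s * 2 ^ s) *
    ((decayWeight s t x₀ w.1 * ‖f w.1‖) * (decayWeight s t x₀ w.2 * ‖g w.2‖)))
    (Eventually.of_forall fun x => aestronglyMeasurable_kernelIntegrand hσ t hf.1 hg.1 x) ?_
    (((integrable_decayWeight_mul hs ht x₀ hp₁ hf).mul_prod
      (integrable_decayWeight_mul hs ht x₀ hp₂ hg)).const_mul _)
    (Eventually.of_forall fun w => ?_)
  · filter_upwards [closedBall_mem_nhds x₀ ht] with x hx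
    refine Eventually.of_forall fun w => (hK.norm_kernelIntegrand_le ht f g x w).trans ?_
    have h1 := decayWeight_le_of_dist_le hs0 ht (mem_closedBall.1 hx) w.1
    have h2 := decayWeight_le_of_dist_le hs0 ht (mem_closedBall.1 hx) w.2
    have h3 := decayWeight_nonneg s ht x w.1
    have h4 := decayWeight_nonneg s ht x w.2
    have h5 := decayWeight_nonneg s ht x₀ w.1
    calc A * ((decayWeight s t x w.1 * ‖f w.1‖) * (decayWeight s t x w.2 * ‖g w.2‖))
        ≤ A * ((2 ^ s * decayWeight s t x₀ w.1 * ‖f w.1‖) *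
            (2 ^ s * decayWeight s t x₀ w.2 * ‖g w.2‖)) := by gcongr
      _ = _ := by ring
  · refine Continuous.continuousAt ?_
    unfold kernelIntegrand
    have hpair : Continuous fun x : Rn n => (t⁻¹ • (x - w.1), t⁻¹ • (x - w.2)) := by fun_prop
    have hker := (continuous_kernel hσ).comp hpair
    simp only [Function.comp_def] at hker
    exact ((continuous_const.mul hker).mul continuous_const).mul continuous_const

theorem KernelDecay.measurable_maximalOp {s A : ℝ} (hK : KernelDecay σ s A) (hs : (n : ℝ) < s)
    (hσ : Integrable (fun v : Rn n × Rn n => σ v.1 v.2) volume) {p₁ p₂ : ℝ≥0∞}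
    (hp₁ : 1 ≤ p₁) (hp₂ : 1 ≤ p₂) {f g : Rn n → ℂ} (hf : MemLp f p₁ volume)
    (hg : MemLp g p₂ volume) : Measurable (maximalOp σ f g) := by
  refine LowerSemicontinuous.measurable ?_
  exact lowerSemicontinuous_iSup fun t => lowerSemicontinuous_iSup fun ht =>
    (hK.continuous_kernelMean hs hσ hp₁ hp₂ hf hg ht).enorm.lowerSemicontinuous

theorem KernelDecay.exists_boundedWith {s A : ℝ} (hK : KernelDecay σ s A) (hn : 1 ≤ n)
    (hs : (n : ℝ) < s) (hσ : Integrable (fun v : Rn n × Rn n => σ v.1 v.2) volume)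
    {p₁ p₂ p : ℝ≥0∞} (hp₁ : 1 < p₁) (hp₂ : 1 < p₂) (hp : p⁻¹ = p₁⁻¹ + p₂⁻¹) :
    ∃ C : ℝ≥0, bilinearNorm (maximalOp σ) p₁ p₂ p ≤ C ∧ BoundedWith (maximalOp σ) p₁ p₂ p C := by
  obtain ⟨C₀, hC₀⟩ := hK.exists_maximalOp_le hs
  obtain ⟨C₁, hC₁⟩ := exists_eLpNorm_hardyLittlewood_le hn hp₁
  obtain ⟨C₂, hC₂⟩ := exists_eLpNorm_hardyLittlewood_le hn hp₂
  have hbdd : BoundedWith (maximalOp σ) p₁ p₂ p (C₀ * C₁ * C₂) := by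
    intro f g hf hg
    have hMf := measurable_hardyLittlewood f
    have hMg := measurable_hardyLittlewood g
    have key : eLpNorm (maximalOp σ f g) p volume ≤
        ((C₀ * C₁ * C₂ : ℝ≥0) : ℝ≥0∞) * eLpNorm f p₁ volume * eLpNorm g p₂ volume := by
      calc eLpNorm (maximalOp σ f g) p volume
          ≤ eLpNorm (fun x => (C₀ * hardyLittlewood f x) * hardyLittlewood g x) p volume :=
            eLpNorm_mono_enorm fun x => hC₀ f g hf.1 hg.1 x
        _ ≤ C₀ * eLpNorm (hardyLittlewood f) p₁ volume *
              eLpNorm (hardyLittlewood g) p₂ volume := by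
            rw [← eLpNorm_ennreal_const_mul _ hMf.aemeasurable (zero_lt_one.trans hp₁).ne']
            exact eLpNorm_ennreal_mul_le (hMf.const_mul _).aemeasurable hMg.aemeasurable
              (zero_lt_one.trans hp₁).ne' (zero_lt_one.trans hp₂).ne' hp
        _ ≤ C₀ * (C₁ * eLpNorm f p₁ volume) * (C₂ * eLpNorm g p₂ volume) := by
            gcongr
            · exact hC₁ f hf.1
            · exact hC₂ g hg.1
        _ = _ := by
            push_cast
            ring
    refine ⟨⟨(hK.measurable_maximalOp hs hσ hp₁.le hp₂.le hf hg).aestronglyMeasurable, ?_⟩, key⟩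
    exact key.trans_lt (ENNReal.mul_lt_top (ENNReal.mul_lt_top ENNReal.coe_lt_top hf.2) hg.2)
  refine ⟨C₀ * C₁ * C₂, ?_, hbdd⟩
  refine iSup₂_le fun f hf => iSup₂_le fun g hg => ?_
  calc eLpNorm (maximalOp σ f g) p volume
      ≤ ((C₀ * C₁ * C₂ : ℝ≥0) : ℝ≥0∞) * eLpNorm f p₁ volume * eLpNorm g p₂ volume :=
        (hbdd f g hf.1 hg.1).2
    _ ≤ ((C₀ * C₁ * C₂ : ℝ≥0) : ℝ≥0∞) * 1 * 1 := by
        gcongr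
        · exact hf.2
        · exact hg.2
    _ = _ := by simp

/-! ### Agreement of the kernel form with the Fourier form. -/

instance isAddHaarMeasure_volume_prod : (volume : Measure (Rn n × Rn n)).IsAddHaarMeasure :=
  Measure.prod.instIsAddHaarMeasure _ _

theorem kernel_scale (hσ : Integrable (fun v : Rn n × Rn n => σ v.1 v.2) volume) {t : ℝ}
    (ht : 0 < t) (u v : Rn n) :
    (((t ^ (2 * n))⁻¹ : ℝ) : ℂ) * kernel σ (t⁻¹ • u) (t⁻¹ • v) =
      ∫ q : Rn n × Rn n, (σ (t • q.1) (t • q.2) : ℂ) *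
        Complex.exp (2 * Real.pi * Complex.I * (inner ℝ u q.1 + inner ℝ v q.2 : ℝ)) := by
  have h := Measure.integral_comp_smul_of_nonneg (volume : Measure (Rn n × Rn n))
    (fun q : Rn n × Rn n => (σ q.1 q.2 : ℂ) * Complex.exp (2 * Real.pi * Complex.I *
      (inner ℝ (t⁻¹ • u) q.1 + inner ℝ (t⁻¹ • v) q.2 : ℝ))) t (hR := ht.le)
  have hd : Module.finrank ℝ (Rn n × Rn n) = 2 * n := by
    simp [two_mul]
  rw [hd, ← kernel_eq_integral_prod hσ, Complex.real_smul] at h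
  rw [← h]
  congr 1 with q
  simp only [Prod.smul_fst, Prod.smul_snd, inner_smul_left, inner_smul_right]
  congr 5
  · simp [ht.ne']
  · simp [ht.ne']

/-- Fubini on ℝ^(2n) × ℝ^(2n): the joint integrand is the integrable function f ⊗ g ⊗ σ(t·) times a
unimodular phase. Integrating the frequencies first gives the rescaled kernel, the positions first
gives the two Fourier transforms. -/
theorem agreesOnSchwartz_of_integrable
    (hσ : Integrable (fun v : Rn n × Rn n => σ v.1 v.2) volume) : AgreesOnSchwartz σ := by
  intro f g t ht x
  set Φ : Rn n × Rn n → Rn n × Rn n → ℂ := fun w q => (σ (t • q.1) (t • q.2) : ℂ) *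
    Complex.exp (2 * Real.pi * Complex.I * (inner ℝ (x - w.1) q.1 + inner ℝ (x - w.2) q.2 : ℝ)) *
    (f w.1 * g w.2) with hΦ
  have hσt : Integrable (fun q : Rn n × Rn n => (σ (t • q.1) (t • q.2) : ℂ)) volume :=
    ((integrable_comp_smul_iff (volume : Measure (Rn n × Rn n))
      (fun v : Rn n × Rn n => σ v.1 v.2) ht.ne').2 hσ).ofReal
  have hfg : Integrable (fun w : Rn n × Rn n => f w.1 * g w.2) volume :=
    f.integrable.mul_prod g.integrable
  have hint : Integrable (Function.uncurry Φ)
      ((volume : Measure (Rn n × Rn n)).prod (volume : Measure (Rn n × Rn n))) := by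
    have h1 := hfg.mul_prod hσt
    have h2 := h1.mul_bdd (c := 1) (g := fun r : (Rn n × Rn n) × (Rn n × Rn n) =>
      Complex.exp (2 * Real.pi * Complex.I *
        (inner ℝ (x - r.1.1) r.2.1 + inner ℝ (x - r.1.2) r.2.2 : ℝ)))
      (continuous_phase.comp (by fun_prop : Continuous
        fun r : (Rn n × Rn n) × (Rn n × Rn n) => ((x - r.1.1, x - r.1.2), r.2))).aestronglyMeasurable
      (Eventually.of_forall fun r => (norm_exp_two_pi_mul_I _).le)
    refine h2.congr (Eventually.of_forall fun r => ?_)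
    simp only [hΦ, Function.uncurry]
    ring
  have hinner : ∀ q : Rn n × Rn n, ∫ w, Φ w q = (σ (t • q.1) (t • q.2) : ℂ) * 𝓕 f q.1 * 𝓕 g q.2 *
      Complex.exp (2 * Real.pi * Complex.I * (inner ℝ x (q.1 + q.2) : ℝ)) := by
    intro q
    have hF : ∀ (h : 𝓢(Rn n, ℂ)) (ξ : Rn n), 𝓕 h ξ =
        ∫ y, Complex.exp (2 * Real.pi * Complex.I * ((-inner ℝ y ξ : ℝ) : ℂ)) * h y := by
      intro h ξ
      rw [SchwartzMap.fourier_coe, Real.fourier_eq']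
      congr 1 with y
      rw [smul_eq_mul]
      congr 2
      push_cast
      ring
    have hsplit : ∀ w : Rn n × Rn n, Φ w q = ((σ (t • q.1) (t • q.2) : ℂ) *
        Complex.exp (2 * Real.pi * Complex.I * (inner ℝ x (q.1 + q.2) : ℝ))) *
        ((Complex.exp (2 * Real.pi * Complex.I * ((-inner ℝ w.1 q.1 : ℝ) : ℂ)) * f w.1) *
        (Complex.exp (2 * Real.pi * Complex.I * ((-inner ℝ w.2 q.2 : ℝ) : ℂ)) * g w.2)) := by
      intro w
      have he : Complex.exp (2 * Real.pi * Complex.I *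
          (inner ℝ (x - w.1) q.1 + inner ℝ (x - w.2) q.2 : ℝ)) =
          Complex.exp (2 * Real.pi * Complex.I * (inner ℝ x (q.1 + q.2) : ℝ)) *
          (Complex.exp (2 * Real.pi * Complex.I * ((-inner ℝ w.1 q.1 : ℝ) : ℂ)) *
          Complex.exp (2 * Real.pi * Complex.I * ((-inner ℝ w.2 q.2 : ℝ) : ℂ))) := by
        rw [← Complex.exp_add, ← Complex.exp_add]
        congr 1
        rw [inner_sub_left, inner_sub_left, inner_add_right]
        push_cast
        ring
      simp only [hΦ]
      rw [he]
      ring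
    simp_rw [hsplit]
    rw [integral_const_mul, Measure.volume_eq_prod,
      integral_prod_mul (fun y => Complex.exp (2 * Real.pi * Complex.I *
        ((-inner ℝ y q.1 : ℝ) : ℂ)) * f y) (fun z => Complex.exp (2 * Real.pi * Complex.I *
        ((-inner ℝ z q.2 : ℝ) : ℂ)) * g z), ← hF, ← hF]
    ring
  have hout : Integrable (fun q : Rn n × Rn n => (σ (t • q.1) (t • q.2) : ℂ) * 𝓕 f q.1 *
      𝓕 g q.2 * Complex.exp (2 * Real.pi * Complex.I * (inner ℝ x (q.1 + q.2) : ℝ)))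
      ((volume : Measure (Rn n)).prod (volume : Measure (Rn n))) := by
    have := hint.integral_prod_right
    exact this.congr (Eventually.of_forall fun q => hinner q)
  calc kernelMean σ t f g x = ∫ w, ∫ q, Φ w q := by
        unfold kernelMean kernelIntegrand
        congr 1 with w
        rw [kernel_scale hσ ht, mul_assoc, ← integral_mul_const]
    _ = ∫ q, ∫ w, Φ w q := integral_integral_swap hint
    _ = ∫ q : Rn n × Rn n, (σ (t • q.1) (t • q.2) : ℂ) * 𝓕 f q.1 * 𝓕 g q.2 *
          Complex.exp (2 * Real.pi * Complex.I * (inner ℝ x (q.1 + q.2) : ℝ)) := by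
        simp_rw [hinner]
    _ = fourierMean σ t f g x := integral_prod _ hout

end Multiplier

/-! ### Decay of one-dimensional Fourier integrals of (1 - s²)^ν. -/

section Oscillatory

/-- The oscillating factor `e ^ (2πi r s)`. -/
noncomputable def osc (r s : ℝ) : ℂ := Complex.exp (2 * Real.pi * Complex.I * ((r * s : ℝ) : ℂ))

theorem norm_osc (r s : ℝ) : ‖osc r s‖ = 1 := norm_exp_two_pi_mul_I _

theorem continuous_osc (r : ℝ) : Continuous (osc r) := by
  unfold osc
  fun_prop

theorem osc_neg (r s : ℝ) : osc (-r) s = (starRingEnd ℂ) (osc r s) := by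
  unfold osc
  rw [← Complex.exp_conj]
  congr 1
  simp only [map_mul, Complex.conj_I, Complex.conj_ofReal, map_ofNat]
  push_cast
  ring

theorem osc_neg_right (r s : ℝ) : osc r (-s) = osc (-r) s := by
  simp [osc]

theorem hasDerivAt_osc (r s : ℝ) :
    HasDerivAt (osc r) (2 * Real.pi * Complex.I * r * osc r s) s := by
  have h : HasDerivAt (fun u : ℝ => 2 * Real.pi * Complex.I * ((r * u : ℝ) : ℂ))
      (2 * Real.pi * Complex.I * ((r * 1 : ℝ) : ℂ)) s :=
    (((hasDerivAt_id s).const_mul r).ofReal_comp).const_mul _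
  refine h.cexp.congr_deriv ?_
  unfold osc
  push_cast
  ring

/-- The Fourier integral of a nonnegative function that increases on `(-∞, 1)` and vanishes on
`[1, ∞)` is controlled by its mass within half a period of `1`. -/
theorem norm_integral_mul_osc_le_of_monotoneOn {G : ℝ → ℝ} (hint : Integrable G volume)
    (hnn : ∀ s, 0 ≤ G s) (hmono : MonotoneOn G (Set.Iio 1)) (hzero : ∀ s, 1 ≤ s → G s = 0)
    {r : ℝ} (hr : 0 < r) :
    ‖∫ s, (G s : ℂ) * osc r s‖ ≤ ∫ s in Set.Ici (1 - 1 / (2 * r)), G s := by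
  set h := 1 / (2 * r) with hh
  have hpos : 0 < h := by positivity
  have hosc : ∀ s, osc r (s - h) = -osc r s := by
    intro s
    unfold osc
    have : 2 * (Real.pi : ℂ) * Complex.I * ((r * (s - h) : ℝ) : ℂ) =
        2 * Real.pi * Complex.I * ((r * s : ℝ) : ℂ) - Real.pi * Complex.I := by
      have hrh : r * h = 1 / 2 := by rw [hh]; field_simp
      rw [mul_sub, hrh]
      push_cast
      ring
    rw [this, Complex.exp_sub, Complex.exp_pi_mul_I]
    ring
  have hGo : Integrable (fun s => (G s : ℂ) * osc r s) volume :=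
    hint.ofReal.mul_bdd (c := 1) (continuous_osc r).aestronglyMeasurable
      (Eventually.of_forall fun s => (norm_osc r s).le)
  have hshift : ∫ s, (G (s - h) : ℂ) * osc r s = -∫ s, (G s : ℂ) * osc r s := by
    rw [← integral_sub_right_eq_self (fun s => (G s : ℂ) * osc r s) h, ← integral_neg]
    congr 1 with s
    rw [hosc]
    ring
  have hGs : Integrable (fun s => G (s - h)) volume := hint.comp_sub_right h
  have hGso : Integrable (fun s => (G (s - h) : ℂ) * osc r s) volume :=
    hGs.ofReal.mul_bdd (c := 1) (continuous_osc r).aestronglyMeasurable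
      (Eventually.of_forall fun s => (norm_osc r s).le)
  -- A shift by the half period h flips the sign of the oscillation, so averaging the two
  -- expressions replaces G by a difference.
  have hdiff : (2 : ℂ) * ∫ s, (G s : ℂ) * osc r s = ∫ s, ((G s - G (s - h) : ℝ) : ℂ) * osc r s := by
    have : ∀ s, ((G s - G (s - h) : ℝ) : ℂ) * osc r s =
        (G s : ℂ) * osc r s - (G (s - h) : ℂ) * osc r s := fun s => by push_cast; ring
    simp_rw [this]
    rw [integral_sub hGo hGso, hshift]
    ring
  -- The difference is nonnegative before 1 by monotonicity and equals -G(s - h) afterwards. Its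
  -- signed integral is zero, so only the correction on [1, ∞) survives.
  have habs : ∀ s, ‖((G s - G (s - h) : ℝ) : ℂ) * osc r s‖ =
      (G s - G (s - h)) + 2 * (Set.Ici 1).indicator (fun s => G (s - h)) s := by
    intro s
    rw [norm_mul, norm_osc, mul_one, Complex.norm_real, Real.norm_eq_abs]
    rcases lt_or_ge s 1 with hs | hs
    · have : G (s - h) ≤ G s := hmono (by simp only [Set.mem_Iio]; linarith) hs (by linarith)
      rw [Set.indicator_of_notMem (by simpa using hs), abs_of_nonneg (by linarith)]
      ring
    · rw [Set.indicator_of_mem (by exact hs), hzero s hs, zero_sub, abs_neg, abs_of_nonneg (hnn _)]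
      ring
  have hind : ∫ s, (Set.Ici 1).indicator (fun s => G (s - h)) s = ∫ s in Set.Ici (1 - h), G s := by
    rw [← integral_indicator measurableSet_Ici,
      ← integral_sub_right_eq_self ((Set.Ici (1 - h)).indicator G) h]
    congr 1 with s
    simp [Set.indicator_apply]
  have htwo : 2 * ‖∫ s, (G s : ℂ) * osc r s‖ ≤ 2 * ∫ s in Set.Ici (1 - h), G s := by
    calc 2 * ‖∫ s, (G s : ℂ) * osc r s‖ = ‖(2 : ℂ) * ∫ s, (G s : ℂ) * osc r s‖ := by simp
      _ = ‖∫ s, ((G s - G (s - h) : ℝ) : ℂ) * osc r s‖ := by rw [hdiff]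
      _ ≤ ∫ s, ‖((G s - G (s - h) : ℝ) : ℂ) * osc r s‖ := norm_integral_le_integral_norm _
      _ = ∫ s, ((G s - G (s - h)) + 2 * (Set.Ici 1).indicator (fun s => G (s - h)) s) := by
          simp_rw [habs]
      _ = 2 * ∫ s in Set.Ici (1 - h), G s := by
          have hsubint : Integrable (fun s => G s - G (s - h)) volume := hint.sub hGs
          rw [integral_add hsubint ((hGs.indicator measurableSet_Ici).const_mul 2),
            integral_sub hint hGs, integral_sub_right_eq_self G h, sub_self, zero_add,
            integral_const_mul, hind]
  linarith

theorem integral_one_sub_rpow {ν : ℝ} (hν : -1 < ν) (h : ℝ) :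
    ∫ s in (1 - h)..1, (1 - s) ^ ν = h ^ (ν + 1) / (ν + 1) := by
  rw [intervalIntegral.integral_comp_sub_left (fun u => u ^ ν) 1, integral_rpow (.inl hν)]
  simp [Real.zero_rpow (by linarith : ν + 1 ≠ 0)]

theorem intervalIntegrable_one_sub_rpow {ν : ℝ} (hν : -1 < ν) (a b : ℝ) :
    IntervalIntegrable (fun s : ℝ => (1 - s) ^ ν) volume a b := by
  have := (intervalIntegral.intervalIntegrable_rpow' (a := 1 - a) (b := 1 - b) hν).comp_sub_left 1
  simpa using this

/-- Extended by zero, g satisfies the half-period estimate, and its mass near 1 is at most ∫ (1 -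
s)^ν over an interval of length 1/(2r). Negative frequencies reduce to positive ones by conjugation.
-/
theorem norm_intervalIntegral_mul_osc_le {g : ℝ → ℝ} {ν : ℝ} (hν : -1 < ν)
    (hint : IntervalIntegrable g volume 0 1) (hnn : ∀ s ∈ Set.Ico (0 : ℝ) 1, 0 ≤ g s)
    (hmono : MonotoneOn g (Set.Ico 0 1)) (hle : ∀ s ∈ Set.Ico (0 : ℝ) 1, g s ≤ (1 - s) ^ ν)
    {r : ℝ} (hr : r ≠ 0) :
    ‖∫ s in (0 : ℝ)..1, (g s : ℂ) * osc r s‖ ≤ (ν + 1)⁻¹ * |r| ^ (-ν - 1) := by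
  wlog hpos : 0 < r generalizing r
  · have hneg : 0 < -r := by
      rcases lt_or_gt_of_ne hr with h | h
      · linarith
      · exact absurd h hpos
    have := this hneg.ne' hneg
    rw [abs_neg] at this
    convert this using 1
    have hc : ∀ s, (g s : ℂ) * osc (-r) s = (starRingEnd ℂ) ((g s : ℂ) * osc r s) := fun s => by
      rw [osc_neg, map_mul, Complex.conj_ofReal]
    simp_rw [hc, intervalIntegral.intervalIntegral_eq_integral_uIoc, norm_smul]
    rw [integral_conj, RCLike.norm_conj]
  set G := (Set.Ico (0 : ℝ) 1).indicator g with hG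
  have hGint : Integrable G volume := by
    rw [hG, integrable_indicator_iff measurableSet_Ico]
    exact (intervalIntegrable_iff_integrableOn_Ico_of_le zero_le_one).1 hint
  have hGnn : ∀ s, 0 ≤ G s := fun s => Set.indicator_nonneg hnn s
  have hGmono : MonotoneOn G (Set.Iio 1) := by
    intro a ha b hb hab
    rcases lt_or_ge a 0 with h | h
    · rw [hG, Set.indicator_of_notMem (by simp [h])]
      exact hGnn b
    · have ha' : a ∈ Set.Ico (0 : ℝ) 1 := ⟨h, ha⟩
      have hb' : b ∈ Set.Ico (0 : ℝ) 1 := ⟨h.trans hab, hb⟩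
      rw [hG, Set.indicator_of_mem ha', Set.indicator_of_mem hb']
      exact hmono ha' hb' hab
  have hGzero : ∀ s, 1 ≤ s → G s = 0 := fun s hs =>
    Set.indicator_of_notMem (by simp [hs]) _
  have hGe : ∫ s in (0 : ℝ)..1, (g s : ℂ) * osc r s = ∫ s, (G s : ℂ) * osc r s := by
    rw [intervalIntegral.integral_of_le zero_le_one, ← integral_Ico_eq_integral_Ioc,
      ← integral_indicator measurableSet_Ico]
    congr 1 with s
    rw [hG]
    by_cases hs : s ∈ Set.Ico (0 : ℝ) 1 <;> simp [hs]
  set h := 1 / (2 * r) with hh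
  have hhpos : 0 < h := by positivity
  have hsub : ∫ s in Set.Ici (1 - h), G s ≤ ∫ s in (1 - h)..1, (1 - s) ^ ν := by
    have hII := intervalIntegrable_one_sub_rpow hν (1 - h) 1
    rw [intervalIntegral.integral_of_le (by linarith), ← integral_Ico_eq_integral_Ioc,
      ← integral_indicator measurableSet_Ici, ← integral_indicator measurableSet_Ico]
    rw [intervalIntegrable_iff_integrableOn_Ico_of_le (by linarith)] at hII
    refine integral_mono (hGint.indicator measurableSet_Ici)
      ((integrable_indicator_iff measurableSet_Ico).2 hII) fun s => ?_
    by_cases hs1 : 1 ≤ s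
    · rw [Set.indicator_of_notMem (s := Set.Ico _ _) (by simp [hs1])]
      simp [Set.indicator_apply, hGzero s hs1]
    by_cases hs2 : 1 - h ≤ s
    · have hs1 := not_le.1 hs1
      rw [Set.indicator_of_mem (s := Set.Ici _) hs2,
        Set.indicator_of_mem (s := Set.Ico _ _) ⟨hs2, hs1⟩]
      by_cases hs0 : 0 ≤ s
      · rw [hG, Set.indicator_of_mem (show s ∈ Set.Ico (0 : ℝ) 1 from ⟨hs0, hs1⟩)]
        exact hle s ⟨hs0, hs1⟩
      · rw [hG, Set.indicator_of_notMem (by simp [hs0])]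
        exact Real.rpow_nonneg (by linarith) _
    · simp [hs2]
  rw [hGe]
  refine (norm_integral_mul_osc_le_of_monotoneOn hGint hGnn hGmono hGzero hpos).trans
    (hsub.trans ?_)
  rw [integral_one_sub_rpow hν, abs_of_pos hpos, div_eq_inv_mul]
  have hν1 : 0 < ν + 1 := by linarith
  gcongr
  rw [show -ν - 1 = -(ν + 1) by ring, Real.rpow_neg hpos.le, ← Real.inv_rpow hpos.le]
  refine Real.rpow_le_rpow hhpos.le ?_ hν1.le
  rw [hh, one_div]
  exact inv_anti₀ hpos (by linarith)

theorem one_sub_sq_rpow_eq {s : ℝ} (hs : s ∈ Set.Icc (-1 : ℝ) 1) (ν : ℝ) :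
    (1 - s ^ 2) ^ ν = (1 - s) ^ ν * (1 + s) ^ ν := by
  rw [← Real.mul_rpow (by linarith [hs.2]) (by linarith [hs.1])]
  congr 1
  ring

theorem intervalIntegrable_one_sub_sq_rpow_right {ν : ℝ} (hν : -1 < ν) :
    IntervalIntegrable (fun s : ℝ => (1 - s ^ 2) ^ ν) volume 0 1 := by
  have h1 := (intervalIntegrable_one_sub_rpow hν 0 1).mul_continuousOn
    (g := fun s : ℝ => (1 + s) ^ ν) (by
      refine ContinuousOn.rpow_const (by fun_prop) fun s hs => .inl ?_
      rw [Set.uIcc_of_le zero_le_one] at hs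
      linarith [hs.1])
  refine h1.congr fun s hs => ?_
  rw [Set.uIoc_of_le zero_le_one] at hs
  exact (one_sub_sq_rpow_eq ⟨by linarith [hs.1], hs.2⟩ ν).symm

theorem intervalIntegrable_one_sub_sq_rpow {ν : ℝ} (hν : -1 < ν) :
    IntervalIntegrable (fun s : ℝ => (1 - s ^ 2) ^ ν) volume (-1) 1 := by
  have h1 := intervalIntegrable_one_sub_sq_rpow_right hν
  have h2 := h1.comp_sub_left 0
  simp only [zero_sub, even_two.neg_pow, neg_zero] at h2
  exact h2.symm.trans h1

/-- The one-dimensional Fourier integral of `(1 - s²) ^ ν` over `[-1, 1]`. -/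
noncomputable def evenOsc (ν r : ℝ) : ℂ :=
  ∫ s in (-1 : ℝ)..1, (((1 - s ^ 2) ^ ν : ℝ) : ℂ) * osc r s

/-- The one-dimensional Fourier integral of `s (1 - s²) ^ ν` over `[-1, 1]`. -/
noncomputable def oddOsc (ν r : ℝ) : ℂ :=
  ∫ s in (-1 : ℝ)..1, ((s * (1 - s ^ 2) ^ ν : ℝ) : ℂ) * osc r s

theorem intervalIntegrable_mul_osc {g : ℝ → ℝ} {a b : ℝ} (hg : IntervalIntegrable g volume a b)
    (r : ℝ) : IntervalIntegrable (fun s => (g s : ℂ) * osc r s) volume a b :=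
  IntervalIntegrable.mul_continuousOn (f := fun s => (g s : ℂ))
    ⟨hg.1.ofReal, hg.2.ofReal⟩ (continuous_osc r).continuousOn

theorem integral_symm_split {g : ℝ → ℝ} (hg : IntervalIntegrable g volume (-1) 1) (r : ℝ) :
    ∫ s in (-1 : ℝ)..1, (g s : ℂ) * osc r s = (∫ s in (0 : ℝ)..1, (g s : ℂ) * osc r s) +
      ∫ s in (0 : ℝ)..1, (g (-s) : ℂ) * osc (-r) s := by
  have h1 : IntervalIntegrable g volume (-1) 0 := hg.mono_set (by
    rw [Set.uIcc_of_le (by norm_num), Set.uIcc_of_le (by norm_num)]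
    exact Set.Icc_subset_Icc le_rfl (by norm_num))
  have h2 : IntervalIntegrable g volume 0 1 := hg.mono_set (by
    rw [Set.uIcc_of_le (by norm_num), Set.uIcc_of_le (by norm_num)]
    exact Set.Icc_subset_Icc (by norm_num) le_rfl)
  rw [← intervalIntegral.integral_add_adjacent_intervals (intervalIntegrable_mul_osc h1 r)
    (intervalIntegrable_mul_osc h2 r), add_comm]
  congr 1
  have := intervalIntegral.integral_comp_neg (a := 0) (b := 1) (fun s => (g s : ℂ) * osc r s)
  rw [neg_zero] at this
  rw [← this]
  simp_rw [osc_neg_right]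

/-- For ν ≤ 0 the profile increases on [0, 1), and 1 - s ≤ 1 - s² gives (1 - s²)^ν ≤ (1 - s)^ν. The
left half is reflected onto the right one. -/
theorem norm_evenOsc_le_of_nonpos {ν : ℝ} (hν : -1 < ν) (hν0 : ν ≤ 0) {r : ℝ} (hr : 0 < r) :
    ‖evenOsc ν r‖ ≤ 2 * (ν + 1)⁻¹ * r ^ (-ν - 1) := by
  have hkey : ∀ q : ℝ, q ≠ 0 → ‖∫ s in (0 : ℝ)..1, (((1 - s ^ 2) ^ ν : ℝ) : ℂ) * osc q s‖ ≤
      (ν + 1)⁻¹ * |q| ^ (-ν - 1) := by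
    intro q hq
    refine norm_intervalIntegral_mul_osc_le hν (intervalIntegrable_one_sub_sq_rpow_right hν)
      (fun s hs => Real.rpow_nonneg (by nlinarith [hs.1, hs.2]) _) ?_ ?_ hq
    · intro a ha b hb hab
      exact Real.rpow_le_rpow_of_nonpos (by nlinarith [hb.1, hb.2])
        (by nlinarith [ha.1]) hν0
    · intro s hs
      exact Real.rpow_le_rpow_of_nonpos (by linarith [hs.2]) (by nlinarith [hs.1, hs.2]) hν0
  unfold evenOsc
  rw [integral_symm_split (intervalIntegrable_one_sub_sq_rpow hν)]
  simp only [even_two.neg_pow]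
  refine (norm_add_le _ _).trans ?_
  have h1 := hkey r hr.ne'
  have h2 := hkey (-r) (neg_ne_zero.2 hr.ne')
  rw [abs_neg] at h2
  rw [abs_of_pos hr] at h1 h2
  linarith

theorem norm_oddOsc_le_of_nonpos {ν : ℝ} (hν : -1 < ν) (hν0 : ν ≤ 0) {r : ℝ} (hr : 0 < r) :
    ‖oddOsc ν r‖ ≤ 2 * (ν + 1)⁻¹ * r ^ (-ν - 1) := by
  have hmon : ∀ a ∈ Set.Ico (0 : ℝ) 1, ∀ b ∈ Set.Ico (0 : ℝ) 1, a ≤ b →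
      (1 - a ^ 2) ^ ν ≤ (1 - b ^ 2) ^ ν := by
    intro a ha b hb hab
    exact Real.rpow_le_rpow_of_nonpos (by nlinarith [hb.1, hb.2])
      (by nlinarith [ha.1]) hν0
  have hnn : ∀ s ∈ Set.Ico (0 : ℝ) 1, 0 ≤ (1 - s ^ 2) ^ ν := fun s hs =>
    Real.rpow_nonneg (by nlinarith [hs.1, hs.2]) _
  have hint : ∀ {a b : ℝ}, IntervalIntegrable (fun s : ℝ => (1 - s ^ 2) ^ ν) volume a b →
      IntervalIntegrable (fun s : ℝ => s * (1 - s ^ 2) ^ ν) volume a b := fun h =>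
    h.continuousOn_mul continuousOn_id
  have hkey : ∀ q : ℝ, q ≠ 0 → ‖∫ s in (0 : ℝ)..1, ((s * (1 - s ^ 2) ^ ν : ℝ) : ℂ) * osc q s‖ ≤
      (ν + 1)⁻¹ * |q| ^ (-ν - 1) := by
    intro q hq
    refine norm_intervalIntegral_mul_osc_le hν
      (hint (intervalIntegrable_one_sub_sq_rpow_right hν))
      (fun s hs => mul_nonneg hs.1 (hnn s hs)) ?_ ?_ hq
    · intro a ha b hb hab
      exact mul_le_mul hab (hmon a ha b hb hab) (hnn a ha) hb.1
    · intro s hs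
      refine (mul_le_of_le_one_left (hnn s hs) hs.2.le).trans ?_
      exact Real.rpow_le_rpow_of_nonpos (by linarith [hs.2]) (by nlinarith [hs.1, hs.2]) hν0
  unfold oddOsc
  rw [integral_symm_split (hint (intervalIntegrable_one_sub_sq_rpow hν))]
  simp only [even_two.neg_pow, neg_mul, Complex.ofReal_neg, intervalIntegral.integral_neg]
  refine (norm_add_le _ _).trans ?_
  rw [norm_neg]
  have h1 := hkey r hr.ne'
  have h2 := hkey (-r) (neg_ne_zero.2 hr.ne')
  rw [abs_neg] at h2
  rw [abs_of_pos hr] at h1 h2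
  linarith

theorem hasDerivAt_one_sub_sq_rpow (ν : ℝ) {s : ℝ} (hs : s ∈ Set.Ioo (-1 : ℝ) 1) :
    HasDerivAt (fun s : ℝ => (1 - s ^ 2) ^ ν) (-2 * ν * (s * (1 - s ^ 2) ^ (ν - 1))) s := by
  have hpos : 0 < 1 - s ^ 2 := by nlinarith [hs.1, hs.2]
  have h1 : HasDerivAt (fun s : ℝ => 1 - s ^ 2) (-(2 * s)) s := by
    simpa using ((hasDerivAt_id s).pow 2).const_sub 1
  convert h1.rpow_const (p := ν) (.inl hpos.ne') using 1
  ring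

theorem continuous_one_sub_sq_rpow {ν : ℝ} (hν : 0 ≤ ν) :
    Continuous (fun s : ℝ => (1 - s ^ 2) ^ ν) :=
  Continuous.rpow_const (by fun_prop) fun _ => .inr hν

/-- Integration by parts; ν > 0 kills the boundary terms. Differentiating the even profile creates
the factor s, which is why the odd integrals must be carried along. -/
theorem evenOsc_eq_oddOsc {ν : ℝ} (hν : 0 < ν) (r : ℝ) :
    2 * Real.pi * Complex.I * r * evenOsc ν r = 2 * ν * oddOsc (ν - 1) r := by
  have hI1 := intervalIntegrable_mul_osc
    ((intervalIntegrable_one_sub_sq_rpow (ν := ν - 1) (by linarith)).continuousOn_mul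
      (g := fun s : ℝ => s) continuousOn_id) r
  have hI2 := intervalIntegrable_mul_osc
    (intervalIntegrable_one_sub_sq_rpow (ν := ν) (by linarith)) r
  have hftc := intervalIntegral.integral_eq_sub_of_hasDerivAt_of_le (a := -1) (b := 1)
    (f := fun s : ℝ => (((1 - s ^ 2) ^ ν : ℝ) : ℂ) * osc r s)
    (f' := fun s : ℝ => (-2 * ν : ℂ) * (((s * (1 - s ^ 2) ^ (ν - 1) : ℝ) : ℂ) * osc r s) +
      (2 * Real.pi * Complex.I * r) * ((((1 - s ^ 2) ^ ν : ℝ) : ℂ) * osc r s))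
    (by norm_num)
    ((Complex.continuous_ofReal.comp (continuous_one_sub_sq_rpow hν.le)).mul
      (continuous_osc r)).continuousOn
    (fun s hs => by
      convert! (hasDerivAt_one_sub_sq_rpow ν hs).ofReal_comp.mul (hasDerivAt_osc r s) using 1
      push_cast
      ring)
    ((hI1.const_mul _).add (hI2.const_mul _))
  rw [intervalIntegral.integral_add (hI1.const_mul _) (hI2.const_mul _),
    intervalIntegral.integral_const_mul, intervalIntegral.integral_const_mul] at hftc
  norm_num [Real.zero_rpow hν.ne'] at hftc
  unfold evenOsc oddOsc
  push_cast
  linear_combination hftc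

theorem hasDerivAt_mul_one_sub_sq_rpow_mul_osc (ν r : ℝ) {s : ℝ} (hs : s ∈ Set.Ioo (-1 : ℝ) 1) :
    HasDerivAt (fun s : ℝ => ((s * (1 - s ^ 2) ^ ν : ℝ) : ℂ) * osc r s)
      (((1 + 2 * ν : ℂ) * ((((1 - s ^ 2) ^ ν : ℝ) : ℂ) * osc r s) +
      (-2 * ν : ℂ) * ((((1 - s ^ 2) ^ (ν - 1) : ℝ) : ℂ) * osc r s)) +
      (2 * Real.pi * Complex.I * r) * (((s * (1 - s ^ 2) ^ ν : ℝ) : ℂ) * osc r s)) s := by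
  have hpos : 0 < 1 - s ^ 2 := by nlinarith [hs.1, hs.2]
  have hpow : (1 - s ^ 2) ^ ν = (1 - s ^ 2) ^ (ν - 1) * (1 - s ^ 2) := by
    rw [Real.rpow_sub_one hpos.ne']
    field_simp
  have hreal : HasDerivAt (fun s : ℝ => s * (1 - s ^ 2) ^ ν)
      (1 * (1 - s ^ 2) ^ ν + s * (-2 * ν * (s * (1 - s ^ 2) ^ (ν - 1)))) s :=
    (hasDerivAt_id s).mul (hasDerivAt_one_sub_sq_rpow ν hs)
  refine (hreal.ofReal_comp.mul (hasDerivAt_osc r s)).congr_deriv ?_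
  rw [hpow]
  push_cast
  ring

/-- Integration by parts again; writing s² = 1 - (1 - s²) in the derivative returns to even profiles
and closes the recursion. -/
theorem oddOsc_eq_evenOsc {ν : ℝ} (hν : 0 < ν) (r : ℝ) :
    2 * Real.pi * Complex.I * r * oddOsc ν r =
      2 * ν * evenOsc (ν - 1) r - (1 + 2 * ν) * evenOsc ν r := by
  have hI0 := intervalIntegrable_mul_osc
    (intervalIntegrable_one_sub_sq_rpow (ν := ν - 1) (by linarith)) r
  have hI1 := intervalIntegrable_mul_osc
    ((intervalIntegrable_one_sub_sq_rpow (ν := ν) (by linarith)).continuousOn_mul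
      (g := fun s : ℝ => s) continuousOn_id) r
  have hI2 := intervalIntegrable_mul_osc
    (intervalIntegrable_one_sub_sq_rpow (ν := ν) (by linarith)) r
  have hftc := intervalIntegral.integral_eq_sub_of_hasDerivAt_of_le (a := -1) (b := 1)
    (f := fun s : ℝ => ((s * (1 - s ^ 2) ^ ν : ℝ) : ℂ) * osc r s)
    (f' := fun s : ℝ => ((1 + 2 * ν : ℂ) * ((((1 - s ^ 2) ^ ν : ℝ) : ℂ) * osc r s) +
      (-2 * ν : ℂ) * ((((1 - s ^ 2) ^ (ν - 1) : ℝ) : ℂ) * osc r s)) +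
      (2 * Real.pi * Complex.I * r) * (((s * (1 - s ^ 2) ^ ν : ℝ) : ℂ) * osc r s))
    (by norm_num)
    ((Complex.continuous_ofReal.comp
      (continuous_id.mul (continuous_one_sub_sq_rpow hν.le))).mul (continuous_osc r)).continuousOn
    (fun s hs => hasDerivAt_mul_one_sub_sq_rpow_mul_osc ν r hs)
    (((hI2.const_mul _).add (hI0.const_mul _)).add (hI1.const_mul _))
  rw [intervalIntegral.integral_add ((hI2.const_mul _).add (hI0.const_mul _)) (hI1.const_mul _),
    intervalIntegral.integral_add (hI2.const_mul _) (hI0.const_mul _),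
    intervalIntegral.integral_const_mul, intervalIntegral.integral_const_mul,
    intervalIntegral.integral_const_mul] at hftc
  norm_num [Real.zero_rpow hν.ne'] at hftc
  unfold evenOsc oddOsc
  push_cast
  linear_combination hftc

/-- Decay of the Fourier integrals of `(1 - s²) ^ ν` and `s (1 - s²) ^ ν` over `[-1, 1]`. -/
theorem exists_norm_evenOsc_oddOsc_le {ν : ℝ} (hν : -1 < ν) :
    ∃ C : ℝ, 0 ≤ C ∧ ∀ r : ℝ, 1 ≤ r →
      ‖evenOsc ν r‖ ≤ C * r ^ (-ν - 1) ∧ ‖oddOsc ν r‖ ≤ C * r ^ (-ν - 1) := by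
  have main : ∀ k : ℕ, ∀ ν : ℝ, -1 < ν → ν ≤ k → ∃ C : ℝ, 0 ≤ C ∧ ∀ r : ℝ, 1 ≤ r →
      ‖evenOsc ν r‖ ≤ C * r ^ (-ν - 1) ∧ ‖oddOsc ν r‖ ≤ C * r ^ (-ν - 1) := by
    intro k
    induction k with
    | zero =>
      intro ν hν hν0
      have hν0 : ν ≤ 0 := by simpa using hν0
      have : 0 < ν + 1 := by linarith
      exact ⟨2 * (ν + 1)⁻¹, by positivity, fun r hr =>
        ⟨norm_evenOsc_le_of_nonpos hν hν0 (by linarith),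
          norm_oddOsc_le_of_nonpos hν hν0 (by linarith)⟩⟩
    | succ k ih =>
      intro ν hν hνk
      rcases le_or_gt ν k with h | h
      · exact ih ν hν h
      have hν0 : 0 < ν := (Nat.cast_nonneg k).trans_lt h
      -- Here ν > k ≥ 0, so ν - 1 is still above -1; dividing by 2πr recovers the power lost in
      -- lowering ν.
      obtain ⟨C, hC0, hC⟩ := ih (ν - 1) (by linarith) (by push_cast at hνk; linarith)
      have hnorm : ∀ r : ℝ, 1 ≤ r → ∀ z : ℂ, r * ‖z‖ ≤ ‖2 * Real.pi * Complex.I * r * z‖ := by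
        intro r hr z
        simp only [norm_mul, Complex.norm_I, Complex.norm_real, Complex.norm_ofNat, mul_one]
        rw [Real.norm_of_nonneg Real.pi_pos.le, Real.norm_of_nonneg (by linarith : (0 : ℝ) ≤ r)]
        have : 1 ≤ 2 * Real.pi := by linarith [Real.pi_gt_three]
        have h2 : 0 ≤ r * ‖z‖ := by positivity
        nlinarith
      have hpow : ∀ r : ℝ, 1 ≤ r → r ^ (-(ν - 1) - 1) = r * r ^ (-ν - 1) := by
        intro r hr
        have hr0 : 0 < r := by linarith
        rw [show -(ν - 1) - 1 = 1 + (-ν - 1) by ring, Real.rpow_add hr0, Real.rpow_one]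
      have heven : ∀ r : ℝ, 1 ≤ r → ‖evenOsc ν r‖ ≤ (2 * ν * C) * r ^ (-ν - 1) := by
        intro r hr
        have hr0 : 0 < r := by linarith
        have h1 := hnorm r hr (evenOsc ν r)
        rw [evenOsc_eq_oddOsc hν0] at h1
        have h2 := (hC r hr).2
        rw [hpow r hr] at h2
        simp only [norm_mul, Complex.norm_real, Complex.norm_ofNat,
          Real.norm_of_nonneg hν0.le] at h1
        refine le_of_mul_le_mul_left (h1.trans ?_) hr0
        calc 2 * ν * ‖oddOsc (ν - 1) r‖ ≤ 2 * ν * (C * (r * r ^ (-ν - 1))) := by gcongr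
          _ = _ := by ring
      have hodd : ∀ r : ℝ, 1 ≤ r →
          ‖oddOsc ν r‖ ≤ (2 * ν * C + (1 + 2 * ν) * (2 * ν * C)) * r ^ (-ν - 1) := by
        intro r hr
        have hr0 : 0 < r := by linarith
        have h1 := hnorm r hr (oddOsc ν r)
        rw [oddOsc_eq_evenOsc hν0] at h1
        have h2 := (hC r hr).1
        rw [hpow r hr] at h2
        have h3 := heven r hr
        refine le_of_mul_le_mul_left (h1.trans ?_) hr0
        refine (norm_sub_le _ _).trans ?_
        have hc : ‖(1 + 2 * ν : ℂ)‖ = 1 + 2 * ν := by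
          rw [show (1 + 2 * ν : ℂ) = ((1 + 2 * ν : ℝ) : ℂ) by push_cast; ring, Complex.norm_real,
            Real.norm_of_nonneg (by positivity)]
        rw [norm_mul, norm_mul, norm_mul, hc, Complex.norm_real, Complex.norm_ofNat,
          Real.norm_of_nonneg hν0.le]
        have hP : 0 ≤ r ^ (-ν - 1) := by positivity
        calc 2 * ν * ‖evenOsc (ν - 1) r‖ + (1 + 2 * ν) * ‖evenOsc ν r‖
            ≤ 2 * ν * (C * (r * r ^ (-ν - 1))) + (1 + 2 * ν) * (2 * ν * C * r ^ (-ν - 1)) := by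
              gcongr
          _ ≤ 2 * ν * (C * (r * r ^ (-ν - 1))) +
              (1 + 2 * ν) * (2 * ν * C * (r * r ^ (-ν - 1))) := by
              gcongr
              exact le_mul_of_one_le_left hP hr
          _ = _ := by ring
      refine ⟨2 * ν * C + (1 + 2 * ν) * (2 * ν * C), by positivity, fun r hr => ⟨?_, hodd r hr⟩⟩
      refine (heven r hr).trans ?_
      have hr0 : 0 < r := by linarith
      gcongr
      exact le_add_of_nonneg_right (by positivity)
  obtain ⟨k, hk⟩ := exists_nat_ge ν
  exact main k ν hν hk

end Oscillatory

/-! ### Radial reduction and the Euclidean structure on the product. -/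

section RadialKernel

/-- The Fourier integral of a radial function on a Euclidean space of dimension `d + 1`, with the
frequency rotated to the first coordinate axis. -/
theorem integral_radial_mul_phase {V : Type*} [NormedAddCommGroup V] [InnerProductSpace ℝ V]
    [FiniteDimensional ℝ V] [MeasurableSpace V] [BorelSpace V] {d : ℕ}
    (hd : Module.finrank ℝ V = d + 1) (ρ : ℝ → ℝ) {w : V} (hw : w ≠ 0) :
    ∫ v : V, (ρ (‖v‖ ^ 2) : ℂ) * Complex.exp (2 * Real.pi * Complex.I * (inner ℝ w v : ℝ)) =
      ∫ q : ℝ × (Fin d → ℝ), (ρ (q.1 ^ 2 + ∑ i, q.2 i ^ 2) : ℂ) * osc ‖w‖ q.1 := by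
  -- The unit vector along w is completed to an orthonormal basis with index 0, so the phase depends
  -- on the first coordinate only.
  have hort : Orthonormal ℝ (({0} : Set (Fin (d + 1))).domRestrict fun _ => ‖w‖⁻¹ • w) := by
    refine ⟨fun i => ?_, fun i j hij => absurd (Subsingleton.elim i j) hij⟩
    simp [Set.domRestrict, norm_smul, hw]
  obtain ⟨b, hb⟩ := hort.exists_orthonormalBasis_extension_of_card_eq (by simpa using hd)
  have hb0 : b 0 = ‖w‖⁻¹ • w := hb 0 rfl
  have hwb : w = ‖w‖ • b 0 := by
    rw [hb0, smul_smul, mul_inv_cancel₀ (norm_ne_zero_iff.2 hw), one_smul]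
  have hmp : MeasurePreserving (b.repr.toMeasurableEquiv.trans
      ((MeasurableEquiv.toLp 2 (Fin (d + 1) → ℝ)).symm.trans
        (MeasurableEquiv.piFinSuccAbove (fun _ : Fin (d + 1) => ℝ) 0))) volume volume :=
    (LinearIsometryEquiv.measurePreserving b.repr).trans
      ((EuclideanSpace.volume_preserving_symm_measurableEquiv_toLp (Fin (d + 1))).trans
        (volume_preserving_piFinSuccAbove (fun _ : Fin (d + 1) => ℝ) 0))
  rw [← hmp.integral_comp']
  congr 1 with v
  have hnorm : ‖v‖ ^ 2 = (b.repr v 0) ^ 2 + ∑ i : Fin d, (b.repr v i.succ) ^ 2 := by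
    rw [← b.repr.norm_map, EuclideanSpace.real_norm_sq_eq, Fin.sum_univ_succ]
  have hin : inner ℝ w v = ‖w‖ * b.repr v 0 := by
    conv_lhs => rw [hwb]
    rw [real_inner_smul_left, b.repr_apply_apply]
  rw [hnorm, hin]
  rfl

variable {n : ℕ}

/-- `ℝⁿ × ℝⁿ` with its Euclidean norm. -/
abbrev Pair (n : ℕ) : Type := WithLp 2 (Rn n × Rn n)

theorem finrank_pair : Module.finrank ℝ (Pair n) = 2 * n := by
  rw [LinearEquiv.finrank_eq (WithLp.linearEquiv 2 ℝ (Rn n × Rn n))]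
  simp [two_mul]

theorem pairNorm_eq (v : Pair n) : pairNorm v.fst v.snd = ‖v‖ :=
  (WithLp.prod_norm_eq_of_L2 v).symm

theorem integrable_prod_of_integrable_pair {σ : Rn n → Rn n → ℝ}
    (h : Integrable (fun v : Pair n => σ v.fst v.snd) volume) :
    Integrable (fun q : Rn n × Rn n => σ q.1 q.2) volume :=
  ((WithLp.volume_preserving_symm_measurableEquiv_toLp_prod (Rn n) (Rn n)).integrable_comp_emb
    (MeasurableEquiv.measurableEmbedding _)).1 h

theorem kernel_eq_integral_pair {σ : Rn n → Rn n → ℝ}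
    (hσ : Integrable (fun q : Rn n × Rn n => σ q.1 q.2) volume) (y z : Rn n) :
    kernel σ y z = ∫ v : Pair n, (σ v.fst v.snd : ℂ) *
      Complex.exp (2 * Real.pi * Complex.I * (inner ℝ (WithLp.toLp 2 (y, z)) v : ℝ)) := by
  rw [kernel_eq_integral_prod hσ,
    ← (WithLp.volume_preserving_symm_measurableEquiv_toLp_prod (Rn n) (Rn n)).integral_comp']
  congr 1 with v

/-- Both |y| and |z| are at most |(y, z)|, so radial decay of order 2s can be shared equally between
the two variables. -/
theorem kernelDecay_of_pair {σ : Rn n → Rn n → ℝ} {s A : ℝ} (hs : 0 ≤ s) (hA : 0 ≤ A)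
    (h : ∀ y z : Rn n, ‖kernel σ y z‖ ≤ A * (1 + ‖(WithLp.toLp 2 (y, z) : Pair n)‖) ^ (-(2 * s))) :
    KernelDecay σ s A := by
  intro y z
  refine (h y z).trans ?_
  set w : Pair n := WithLp.toLp 2 (y, z) with hw
  have hsq := WithLp.prod_norm_sq_eq_of_L2 w
  have hy : ‖y‖ ≤ ‖w‖ := by
    refine le_of_sq_le_sq ?_ (norm_nonneg w)
    rw [hsq]
    exact le_add_of_nonneg_right (sq_nonneg _)
  have hz : ‖z‖ ≤ ‖w‖ := by
    refine le_of_sq_le_sq ?_ (norm_nonneg w)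
    rw [hsq]
    exact le_add_of_nonneg_left (sq_nonneg _)
  rw [show -(2 * s) = -s + -s by ring, Real.rpow_add (by positivity)]
  gcongr ?_ * (?_ * ?_)
  · exact Real.rpow_le_rpow_of_nonpos (by positivity) (by linarith) (by linarith)
  · exact Real.rpow_le_rpow_of_nonpos (by positivity) (by linarith) (by linarith)

end RadialKernel

/-! ### Kernel of the full Bochner-Riesz symbol. -/

section BochnerRieszKernel

variable {n : ℕ}

theorem continuous_max_rpow {lam : ℝ} (hlam : 0 < lam) :
    Continuous fun a : ℝ => (max 0 (1 - a)) ^ lam :=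
  Continuous.rpow_const (by fun_prop) fun _ => .inr hlam.le

theorem max_rpow_eq_zero {lam : ℝ} (hlam : 0 < lam) {a : ℝ} (ha : 1 ≤ a) :
    (max 0 (1 - a)) ^ lam = 0 := by
  rw [max_eq_left (by linarith), Real.zero_rpow hlam.ne']

theorem integrable_bochnerRiesz {lam : ℝ} (hlam : 0 < lam) :
    Integrable (fun q : Rn n × Rn n => bochnerRiesz n lam q.1 q.2) volume := by
  refine integrable_prod_of_integrable_pair (σ := bochnerRiesz n lam) ?_
  have heq : (fun v : Pair n => bochnerRiesz n lam v.fst v.snd) =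
      fun v => (max 0 (1 - ‖v‖ ^ 2)) ^ lam := by
    funext v
    rw [bochnerRiesz, WithLp.prod_norm_sq_eq_of_L2]
  rw [heq]
  refine Continuous.integrable_of_hasCompactSupport
    ((continuous_max_rpow hlam).comp (by fun_prop : Continuous fun v : Pair n => ‖v‖ ^ 2)) ?_
  refine HasCompactSupport.of_support_subset_isCompact (isCompact_closedBall (0 : Pair n) 1) ?_
  intro v hv
  by_contra hv'
  rw [mem_closedBall_zero_iff, not_le] at hv'
  exact hv (max_rpow_eq_zero hlam (by nlinarith))

theorem integrable_max_rpow_sum {lam : ℝ} (hlam : 0 < lam) (d : ℕ) :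
    Integrable (fun q : ℝ × (Fin d → ℝ) =>
      (max 0 (1 - (q.1 ^ 2 + ∑ i, q.2 i ^ 2))) ^ lam) volume := by
  refine Continuous.integrable_of_hasCompactSupport ((continuous_max_rpow hlam).comp
    (by fun_prop : Continuous fun q : ℝ × (Fin d → ℝ) => q.1 ^ 2 + ∑ i, q.2 i ^ 2)) ?_
  refine HasCompactSupport.of_support_subset_isCompact
    (isCompact_closedBall (0 : ℝ × (Fin d → ℝ)) 1) ?_
  intro q hq
  have hlt : q.1 ^ 2 + ∑ i, q.2 i ^ 2 < 1 := by
    by_contra h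
    exact hq (max_rpow_eq_zero hlam (not_lt.1 h))
  have hsum : 0 ≤ ∑ i, q.2 i ^ 2 := Finset.sum_nonneg fun i _ => sq_nonneg _
  rw [mem_closedBall_zero_iff, Prod.norm_def]
  refine max_le ?_ ((pi_norm_le_iff_of_nonneg zero_le_one).2 fun i => ?_)
  · rw [Real.norm_eq_abs, ← sq_le_one_iff_abs_le_one]
    linarith
  · rw [Real.norm_eq_abs, ← sq_le_one_iff_abs_le_one]
    have := Finset.single_le_sum (f := fun i => q.2 i ^ 2) (fun i _ => sq_nonneg _)
      (Finset.mem_univ i)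
    nlinarith [sq_nonneg q.1]

/-- Dilate u by √(1 - s²): the symbol contributes the power lam and the Jacobian contributes d/2. -/
theorem integral_max_rpow_slice (lam : ℝ) (d : ℕ) {s : ℝ}
    (hs : s ∈ Set.Ioo (-1 : ℝ) 1) :
    ∫ u : Fin d → ℝ, (max 0 (1 - (s ^ 2 + ∑ i, u i ^ 2))) ^ lam =
      (1 - s ^ 2) ^ (lam + d / 2) * ∫ u : Fin d → ℝ, (max 0 (1 - ∑ i, u i ^ 2)) ^ lam := by
  have hpos : 0 < 1 - s ^ 2 := by nlinarith [hs.1, hs.2]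
  set a := 1 - s ^ 2 with ha
  set c := Real.sqrt a with hc
  have hc0 : 0 < c := Real.sqrt_pos.2 hpos
  have hc2 : c ^ 2 = a := Real.sq_sqrt hpos.le
  have h := Measure.integral_comp_smul_of_nonneg (volume : Measure (Fin d → ℝ))
    (fun u => (max 0 (1 - (s ^ 2 + ∑ i, u i ^ 2))) ^ lam) c (hR := hc0.le)
  have hscale : ∀ u : Fin d → ℝ, (max 0 (1 - (s ^ 2 + ∑ i, (c • u) i ^ 2))) ^ lam =
      a ^ lam * (max 0 (1 - ∑ i, u i ^ 2)) ^ lam := by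
    intro u
    rw [← Real.mul_rpow hpos.le (le_max_left _ _), mul_max_of_nonneg _ _ hpos.le, mul_zero]
    congr 2
    simp only [Pi.smul_apply, smul_eq_mul, mul_pow, ← Finset.mul_sum, hc2]
    rw [ha]
    ring
  simp_rw [hscale] at h
  rw [integral_const_mul, Module.finrank_fin_fun, smul_eq_mul, eq_inv_mul_iff_mul_eq₀
    (by positivity)] at h
  rw [← h, Real.rpow_add hpos, hc, Real.sqrt_eq_rpow, ← Real.rpow_natCast, ← Real.rpow_mul hpos.le]
  rw [show (1 / 2 * d : ℝ) = d / 2 by ring]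
  ring

theorem integral_max_rpow_mul_osc {lam : ℝ} (hlam : 0 < lam) (d : ℕ) (r : ℝ) :
    ∫ q : ℝ × (Fin d → ℝ), (((max 0 (1 - (q.1 ^ 2 + ∑ i, q.2 i ^ 2))) ^ lam : ℝ) : ℂ) * osc r q.1 =
      ((∫ u : Fin d → ℝ, (max 0 (1 - ∑ i, u i ^ 2)) ^ lam : ℝ) : ℂ) *
        evenOsc (lam + d / 2) r := by
  have hint : Integrable (fun q : ℝ × (Fin d → ℝ) =>
      (((max 0 (1 - (q.1 ^ 2 + ∑ i, q.2 i ^ 2))) ^ lam : ℝ) : ℂ) * osc r q.1) volume :=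
    (integrable_max_rpow_sum hlam d).ofReal.mul_bdd (c := 1)
      ((continuous_osc r).comp continuous_fst).aestronglyMeasurable
      (Eventually.of_forall fun q => (norm_osc r q.1).le)
  rw [Measure.volume_eq_prod, integral_prod _ hint]
  simp only [integral_mul_const]
  set c := ∫ u : Fin d → ℝ, (max 0 (1 - ∑ i, u i ^ 2)) ^ lam with hc
  have hslice : ∀ s : ℝ, (∫ u : Fin d → ℝ,
      (((max 0 (1 - (s ^ 2 + ∑ i, u i ^ 2))) ^ lam : ℝ) : ℂ)) * osc r s =
      (Set.Ioo (-1 : ℝ) 1).indicator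
        (fun s => (c : ℂ) * ((((1 - s ^ 2) ^ (lam + d / 2) : ℝ) : ℂ) * osc r s)) s := by
    intro s
    rw [integral_complex_ofReal]
    by_cases hs : s ∈ Set.Ioo (-1 : ℝ) 1
    · rw [Set.indicator_of_mem hs, integral_max_rpow_slice lam d hs, ← hc]
      push_cast
      ring
    · rw [Set.indicator_of_notMem hs]
      have hs2 : 1 ≤ s ^ 2 := by
        rw [one_le_sq_iff_one_le_abs]
        by_contra h
        exact hs (abs_lt.1 (not_le.1 h))
      have hz : ∀ u : Fin d → ℝ, (max 0 (1 - (s ^ 2 + ∑ i, u i ^ 2))) ^ lam = 0 := fun u =>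
        max_rpow_eq_zero hlam (by
          have : 0 ≤ ∑ i, u i ^ 2 := Finset.sum_nonneg fun i _ => sq_nonneg _
          linarith)
      simp [hz]
  simp_rw [hslice]
  rw [integral_indicator measurableSet_Ioo, integral_const_mul, ← integral_Ioc_eq_integral_Ioo,
    ← intervalIntegral.integral_of_le (by norm_num)]
  rfl

theorem kernel_bochnerRiesz_eq {lam : ℝ} (hlam : 0 < lam) {d : ℕ} (hd : 2 * n = d + 1)
    {y z : Rn n} (hyz : (WithLp.toLp 2 (y, z) : Pair n) ≠ 0) :
    kernel (bochnerRiesz n lam) y z =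
      ((∫ u : Fin d → ℝ, (max 0 (1 - ∑ i, u i ^ 2)) ^ lam : ℝ) : ℂ) *
        evenOsc (lam + d / 2) ‖(WithLp.toLp 2 (y, z) : Pair n)‖ := by
  rw [kernel_eq_integral_pair (integrable_bochnerRiesz hlam), ← integral_max_rpow_mul_osc hlam,
    ← integral_radial_mul_phase (finrank_pair.trans hd) (fun a => (max 0 (1 - a)) ^ lam) hyz]
  congr 1 with v
  rw [bochnerRiesz, WithLp.prod_norm_sq_eq_of_L2]

theorem norm_kernel_le {σ : Rn n → Rn n → ℝ}
    (hσ : Integrable (fun q : Rn n × Rn n => σ q.1 q.2) volume) (y z : Rn n) :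
    ‖kernel σ y z‖ ≤ ∫ q : Rn n × Rn n, ‖σ q.1 q.2‖ := by
  rw [kernel_eq_integral_prod hσ]
  refine (norm_integral_le_integral_norm _).trans (le_of_eq ?_)
  congr 1 with q
  rw [norm_mul, norm_exp_two_pi_mul_I, mul_one, Complex.norm_real]

theorem exists_kernelDecay_bochnerRiesz (hn : 1 ≤ n) {lam : ℝ} (hlam : 0 < lam)
    (hcrit : (n : ℝ) - 1 / 2 < lam) :
    ∃ s A : ℝ, (n : ℝ) < s ∧ KernelDecay (bochnerRiesz n lam) s A := by
  obtain ⟨d, hd⟩ : ∃ d : ℕ, 2 * n = d + 1 := ⟨2 * n - 1, by lia⟩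
  have hdr : (d : ℝ) = 2 * n - 1 := by
    have : (2 * n : ℝ) = d + 1 := by exact_mod_cast hd
    linarith
  set ν : ℝ := lam + d / 2 with hν
  have hn0 : (1 : ℝ) ≤ n := by exact_mod_cast hn
  have hν1 : -1 < ν := by rw [hν, hdr]; linarith
  obtain ⟨C, hC0, hC⟩ := exists_norm_evenOsc_oddOsc_le hν1
  set c := ∫ u : Fin d → ℝ, (max 0 (1 - ∑ i, u i ^ 2)) ^ lam
  set B := ∫ q : Rn n × Rn n, ‖bochnerRiesz n lam q.1 q.2‖
  have hB : 0 ≤ B := integral_nonneg fun q => norm_nonneg _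
  -- Here 2s = lam + n + 1/2 because d = 2n - 1, so s > n is exactly the condition lam > n - 1/2.
  set s := (ν + 1) / 2 with hs
  have hns : (n : ℝ) < s := by rw [hs, hν, hdr]; linarith
  have hs0 : 0 ≤ s := by linarith
  refine ⟨s, 2 ^ (2 * s) * (|c| * C + B), hns, kernelDecay_of_pair hs0 (by positivity) ?_⟩
  intro y z
  set w : Pair n := WithLp.toLp 2 (y, z) with hw
  -- Used with R = |w| where the oscillatory decay applies, and with R = 1 for |w| ≤ 1, where the L¹
  -- norm of the symbol bounds the kernel.
  have hbase : ∀ R : ℝ, 0 < R → 1 + ‖w‖ ≤ 2 * R →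
      R ^ (-(2 * s)) ≤ 2 ^ (2 * s) * (1 + ‖w‖) ^ (-(2 * s)) := by
    intro R hR hle
    have h1 : (2 * R) ^ (-(2 * s)) ≤ (1 + ‖w‖) ^ (-(2 * s)) :=
      Real.rpow_le_rpow_of_nonpos (by positivity) hle (by linarith)
    rw [Real.mul_rpow (by norm_num) hR.le, Real.rpow_neg (by norm_num : (0 : ℝ) ≤ 2),
      inv_mul_le_iff₀ (by positivity)] at h1
    exact h1
  rcases le_total 1 ‖w‖ with h1 | h1
  · have hw0 : w ≠ 0 := by
      rintro h0
      rw [h0, norm_zero] at h1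
      linarith
    rw [kernel_bochnerRiesz_eq hlam hd hw0, norm_mul, Complex.norm_real, Real.norm_eq_abs]
    have h2 := (hC ‖w‖ h1).1
    rw [show -ν - 1 = -(2 * s) by rw [hs]; ring] at h2
    have h3 := hbase ‖w‖ (by linarith) (by linarith)
    calc |c| * ‖evenOsc ν ‖w‖‖ ≤ |c| * (C * (2 ^ (2 * s) * (1 + ‖w‖) ^ (-(2 * s)))) := by
          gcongr
          exact h2.trans (by gcongr)
      _ ≤ |c| * (C * (2 ^ (2 * s) * (1 + ‖w‖) ^ (-(2 * s)))) +
          2 ^ (2 * s) * B * (1 + ‖w‖) ^ (-(2 * s)) := le_add_of_nonneg_right (by positivity)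
      _ = _ := by ring
  · have h3 := hbase 1 one_pos (by linarith)
    rw [Real.one_rpow] at h3
    calc ‖kernel (bochnerRiesz n lam) y z‖ ≤ B * 1 := by
          rw [mul_one]
          exact norm_kernel_le (integrable_bochnerRiesz hlam) y z
      _ ≤ B * (2 ^ (2 * s) * (1 + ‖w‖) ^ (-(2 * s))) := by gcongr
      _ ≤ B * (2 ^ (2 * s) * (1 + ‖w‖) ^ (-(2 * s))) +
          2 ^ (2 * s) * (|c| * C) * (1 + ‖w‖) ^ (-(2 * s)) :=
          le_add_of_nonneg_right (by positivity)
      _ = _ := by ring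

end BochnerRieszKernel

/-! ### Smoothness and kernel decay of the pieces m_j. -/

section Pieces

variable {n : ℕ} {φ : ℝ → ℝ}

theorem IsCutoff.cutoffScale_eq_zero (hφ : IsCutoff φ) {k : ℕ} {s : ℝ}
    (hs : 1 - ((2 : ℝ) ^ (k + 1))⁻¹ ≤ s) : cutoffScale φ k s = 0 := by
  refine hφ.eq_zero _ ?_
  have h2 : (0 : ℝ) < 2 ^ k := by positivity
  calc (1 : ℝ) = 2 ^ (k + 1) * ((1 - ((2 : ℝ) ^ (k + 1))⁻¹) + ((2 : ℝ) ^ k)⁻¹ - 1) := by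
        rw [pow_succ]
        field_simp
        ring
    _ ≤ _ := by gcongr

theorem IsCutoff.cutoffScale_eq_one (hφ : IsCutoff φ) {k : ℕ} (hk : 1 ≤ k) {s : ℝ}
    (hs : s ≤ 1 / 2) : cutoffScale φ k s = 1 := by
  refine hφ.eq_one _ ?_
  have h2 : (2 : ℝ) ≤ 2 ^ k := le_self_pow₀ one_le_two (by lia)
  calc (2 : ℝ) ^ (k + 1) * (s + ((2 : ℝ) ^ k)⁻¹ - 1)
      ≤ 2 ^ (k + 1) * (1 / 2 + ((2 : ℝ) ^ k)⁻¹ - 1) := by gcongr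
    _ = 2 - 2 ^ k := by
        rw [pow_succ]
        field_simp
        ring
    _ ≤ _ := by linarith

theorem IsCutoff.contDiff_cutoffScale (hφ : IsCutoff φ) (k : ℕ) :
    ContDiff ℝ ∞ (cutoffScale φ k) := by
  unfold cutoffScale
  exact hφ.smooth.comp (by fun_prop)

theorem IsCutoff.contDiff_psi (hφ : IsCutoff φ) (j : ℕ) : ContDiff ℝ ∞ (psi φ j) := by
  unfold psi
  split_ifs
  · exact hφ.contDiff_cutoffScale 1
  · exact (hφ.contDiff_cutoffScale _).sub (hφ.contDiff_cutoffScale _)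

/-- The finest cutoff in ψ_j is φ_(j+1), also for j = 0 where ψ_0 = φ_1; this accounts for the
exponent j + 2. -/
theorem IsCutoff.psi_eq_zero (hφ : IsCutoff φ) (j : ℕ) {s : ℝ}
    (hs : 1 - ((2 : ℝ) ^ (j + 2))⁻¹ ≤ s) : psi φ j s = 0 := by
  unfold psi
  split_ifs with hj
  · subst hj
    exact hφ.cutoffScale_eq_zero hs
  · rw [hφ.cutoffScale_eq_zero hs, hφ.cutoffScale_eq_zero (le_trans ?_ hs), sub_zero]
    gcongr <;> norm_num

theorem IsCutoff.psi_eq_const (hφ : IsCutoff φ) (j : ℕ) {s : ℝ} (hs : s ≤ 1 / 2) :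
    psi φ j s = if j = 0 then 1 else 0 := by
  unfold psi
  split_ifs with hj
  · exact hφ.cutoffScale_eq_one le_rfl hs
  · rw [hφ.cutoffScale_eq_one (by lia) hs, hφ.cutoffScale_eq_one (by lia) hs, sub_self]

theorem bochnerRieszPiece_eq (lam : ℝ) (j : ℕ) (v : Pair n) :
    bochnerRieszPiece n lam φ j v.fst v.snd = (max 0 (1 - ‖v‖ ^ 2)) ^ lam * psi φ j ‖v‖ := by
  rw [bochnerRieszPiece, bochnerRiesz, pairNorm_eq, WithLp.prod_norm_sq_eq_of_L2]

/-- Inside the unit ball the base 1 - |v|² is positive, so the power is smooth. The norm is not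
smooth at the origin, but ψ_j is constant on (-∞, 1/2]. Near and beyond the unit sphere ψ_j
vanishes. -/
theorem contDiff_bochnerRieszPiece (hφ : IsCutoff φ) (lam : ℝ) (j : ℕ) :
    ContDiff ℝ ∞ fun v : Pair n => bochnerRieszPiece n lam φ j v.fst v.snd := by
  simp_rw [bochnerRieszPiece_eq]
  refine contDiff_iff_contDiffAt.2 fun v => ?_
  rcases lt_or_ge ‖v‖ 1 with hv | hv
  · refine ContDiffAt.mul ?_ ?_
    · have hpos : 0 < 1 - ‖v‖ ^ 2 := by nlinarith [norm_nonneg v]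
      have hsm : ContDiffAt ℝ ∞ (fun u : Pair n => (1 - ‖u‖ ^ 2) ^ lam) v :=
        (contDiff_const.sub (contDiff_norm_sq ℝ)).contDiffAt.rpow_const_of_ne hpos.ne'
      refine hsm.congr_of_eventuallyEq ?_
      have hcont : Continuous fun u : Pair n => 1 - ‖u‖ ^ 2 := by fun_prop
      filter_upwards [hcont.continuousAt.eventually (lt_mem_nhds hpos)] with u hu
      rw [max_eq_right hu.le]
    · by_cases h0 : v = 0
      · subst h0
        refine (contDiffAt_const (c := if j = 0 then (1 : ℝ) else 0)).congr_of_eventuallyEq ?_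
        filter_upwards [Metric.ball_mem_nhds (0 : Pair n) (by norm_num : (0 : ℝ) < 1 / 2)] with u hu
        exact hφ.psi_eq_const j (mem_ball_zero_iff.1 hu).le
      · exact (hφ.contDiff_psi j).contDiffAt.comp v (contDiffAt_norm ℝ h0)
  · refine (contDiffAt_const (c := (0 : ℝ))).congr_of_eventuallyEq ?_
    have hlt : 1 - ((2 : ℝ) ^ (j + 2))⁻¹ < ‖v‖ := by
      have : (0 : ℝ) < ((2 : ℝ) ^ (j + 2))⁻¹ := by positivity
      linarith
    filter_upwards [continuous_norm.continuousAt.eventually (lt_mem_nhds hlt)] with u hu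
    rw [hφ.psi_eq_zero j hu.le, mul_zero]

theorem hasCompactSupport_bochnerRieszPiece (hφ : IsCutoff φ) (lam : ℝ) (j : ℕ) :
    HasCompactSupport fun v : Pair n => bochnerRieszPiece n lam φ j v.fst v.snd := by
  refine HasCompactSupport.of_support_subset_isCompact
    (isCompact_closedBall (0 : Pair n) 1) fun v hv => ?_
  by_contra hv'
  rw [mem_closedBall_zero_iff, not_le] at hv'
  refine hv ?_
  have : (0 : ℝ) < ((2 : ℝ) ^ (j + 2))⁻¹ := by positivity
  simp only [bochnerRieszPiece_eq]
  rw [hφ.psi_eq_zero j (by linarith), mul_zero]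

theorem integrable_bochnerRieszPiece (hφ : IsCutoff φ) (lam : ℝ) (j : ℕ) :
    Integrable (fun q : Rn n × Rn n => bochnerRieszPiece n lam φ j q.1 q.2) volume :=
  integrable_prod_of_integrable_pair
    ((contDiff_bochnerRieszPiece hφ lam j).continuous.integrable_of_hasCompactSupport
      (hasCompactSupport_bochnerRieszPiece hφ lam j))

theorem exists_kernelDecay_bochnerRieszPiece (hφ : IsCutoff φ) (lam : ℝ) (j : ℕ) :
    ∃ s A : ℝ, (n : ℝ) < s ∧ KernelDecay (bochnerRieszPiece n lam φ j) s A := by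
  have hsupp : HasCompactSupport
      fun v : Pair n => (bochnerRieszPiece n lam φ j v.fst v.snd : ℂ) :=
    (hasCompactSupport_bochnerRieszPiece hφ lam j).comp_left (g := Complex.ofReal) rfl
  have hsm : ContDiff ℝ ∞ fun v : Pair n => (bochnerRieszPiece n lam φ j v.fst v.snd : ℂ) :=
    Complex.ofRealCLM.contDiff.comp (contDiff_bochnerRieszPiece hφ lam j)
  set S : 𝓢(Pair n, ℂ) := hsupp.toSchwartzMap hsm with hS
  have hker : ∀ y z : Rn n, kernel (bochnerRieszPiece n lam φ j) y z =
      (𝓕⁻ S) (WithLp.toLp 2 (y, z)) := by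
    intro y z
    rw [kernel_eq_integral_pair (integrable_bochnerRieszPiece hφ lam j), SchwartzMap.fourierInv_coe,
      Real.fourierInv_eq']
    congr 1 with v
    rw [smul_eq_mul, mul_comm, real_inner_comm]
    congr 2
    push_cast
    ring
  -- Any order of Schwartz decay is available; this one gives each variable the exponent n + 1 > n.
  set k : ℕ := 2 * (n + 1) with hk
  set A : ℝ := 2 ^ k * (Finset.Iic (k, 0)).sup
    (fun m => SchwartzMap.seminorm ℝ m.1 m.2) (𝓕⁻ S) with hA
  have hdec : ∀ w : Pair n, (1 + ‖w‖) ^ k * ‖(𝓕⁻ S) w‖ ≤ A := by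
    intro w
    simpa using SchwartzMap.one_add_le_sup_seminorm_apply (𝕜 := ℝ) (m := (k, 0)) (le_refl k)
      (le_refl 0) (𝓕⁻ S) w
  have hA0 : 0 ≤ A := le_trans (by positivity) (hdec 0)
  refine ⟨n + 1, A, by linarith, kernelDecay_of_pair (by positivity) hA0 fun y z => ?_⟩
  set w : Pair n := WithLp.toLp 2 (y, z)
  rw [hker, show -(2 * ((n : ℝ) + 1)) = -((k : ℕ) : ℝ) by rw [hk]; push_cast; ring,
    Real.rpow_neg (by positivity), Real.rpow_natCast, ← div_eq_mul_inv,
    le_div_iff₀ (by positivity), mul_comm]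
  exact hdec w

end Pieces

end BilinearBochnerRiesz

open BilinearBochnerRiesz in
theorem mainTheorem5 (n : ℕ) (hn : 1 ≤ n) (φ : ℝ → ℝ) (hφ : IsCutoff φ)
    (lam : ℝ) (hlam : 0 < lam) :
    ((n : ℝ) - 1 / 2 < lam →
      AgreesOnSchwartz (bochnerRiesz n lam) ∧
      (∃ C : ℝ≥0, ∀ p₁ p₂ : ℝ≥0∞, 1 < p₁ → 1 < p₂ →
        ∀ f g : Rn n → ℂ, MemLp f p₁ volume → MemLp g p₂ volume → ∀ x : Rn n,
          Tstar n lam f g x ≤ C * hardyLittlewood f x * hardyLittlewood g x) ∧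
      ∀ p₁ p₂ p : ℝ≥0∞, 1 < p₁ → 1 < p₂ → p⁻¹ = p₁⁻¹ + p₂⁻¹ →
        ConvergesOn (bochnerRiesz n lam) p₁ p₂ ∧
        ∃ C : ℝ≥0, bilinearNorm (Tstar n lam) p₁ p₂ p ≤ C ∧
          BoundedWith (Tstar n lam) p₁ p₂ p C) ∧
    (∀ j : ℕ,
      AgreesOnSchwartz (bochnerRieszPiece n lam φ j) ∧
      ∀ p₁ p₂ p : ℝ≥0∞, 1 < p₁ → 1 < p₂ → p⁻¹ = p₁⁻¹ + p₂⁻¹ →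
        ConvergesOn (bochnerRieszPiece n lam φ j) p₁ p₂ ∧
        ∃ C : ℝ≥0, bilinearNorm (Tpiece n lam φ j) p₁ p₂ p ≤ C ∧
          BoundedWith (Tpiece n lam φ j) p₁ p₂ p C) := by
  refine ⟨fun hcrit => ?_, fun j => ?_⟩
  · obtain ⟨s, A, hs, hK⟩ := exists_kernelDecay_bochnerRiesz hn hlam hcrit
    have hσ := integrable_bochnerRiesz (n := n) hlam
    refine ⟨agreesOnSchwartz_of_integrable hσ, ?_, fun p₁ p₂ p hp₁ hp₂ hp =>
      ⟨hK.convergesOn hs hσ hp₁.le hp₂.le, hK.exists_boundedWith hn hs hσ hp₁ hp₂ hp⟩⟩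
    obtain ⟨C, hC⟩ := hK.exists_maximalOp_le hs
    exact ⟨C, fun _ _ _ _ f g hf hg x => hC f g hf.1 hg.1 x⟩
  · obtain ⟨s, A, hs, hK⟩ := exists_kernelDecay_bochnerRieszPiece (n := n) hφ lam j
    have hσ := integrable_bochnerRieszPiece (n := n) hφ lam j
    exact ⟨agreesOnSchwartz_of_integrable hσ, fun p₁ p₂ p hp₁ hp₂ hp =>
      ⟨hK.convergesOn hs hσ hp₁.le hp₂.le, hK.exists_boundedWith hn hs hσ hp₁ hp₂ hp⟩⟩
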